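/- Let $\mathbb{K}$ be a field of characteristic $0$, let $V$ be a $3$-dimensional $\mathbb{K}$-vector space, and let $S=\mathbb{K}[V^*]$ be the graded algebra of polynomial functions on $V$. Let $\mathcal{A}$ be a central hyperplane arrangement in $V$, i.e. a finite set of $2$-dimensional linear subspaces of $V$, and let $H\in\mathcal{A}$. For an arrangement $\mathcal{B}$ in a finite-dimensional vector space $W$ with multiplicities $\mathbf{k}:\mathcal{B}\to\mathbb{Z}_{\ge 0}$, let $D(\mathcal{B},\mathbf{k})$ be the $\mathbb{K}[W^*]$-module of all polynomial vector fields $\delta$ on $W$ such that $\delta(\alpha_L)\in\alpha_L^{\mathbf{k}(L)}\,\mathbb{K}[W^*]$ for every $L\in\mathcal{B}$, where $\alpha_L$ is a linear form with kernel $L$. The degree of a homogeneous vector field is the degree of its polynomial coefficients. If $D(\mathcal{B},\mathbf{k})$ has a homogeneous basis, the degrees of its members are called the multiexponents of $(\mathcal{B},\mathbf{k})$. The arrangement $\mathcal{A}$ is called free if $D(\mathcal{A})=D(\mathcal{A},1)$ is a free $S$-module. The characteristic polynomial of $\mathcal{A}$ is $$\chi(\mathcal{A},t)=\sum_{X\in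 L_{\mathcal{A}}}\mu(X)\,t^{\dim X},$$ where $L_{\mathcal{A}}$ is the set of all intersections of members of $\mathcal{A}$ (including $V$), ordered by reverse inclusion, and $\mu$ is its Möbius function: $\mu(V)=1$ and $\mu(X)=-\sum_{Y\supsetneq X}\mu(Y)$ for $X\neq V$. The restricted multiarrangement $(\mathcal{A}^H,\mathbf{k})$ on $H$ consists of the lines $H'\cap H$ with $H'\in\mathcal{A}\setminus\{H\}$, a line $X$ having multiplicity $\mathbf{k}(X)=\#\{H'\in\mathcal{A} : H'\cap H=X\}$. Then $D(\mathcal{A}^H,\mathbf{k})$ has a homogeneous basis with two elements, and if $(d_2',d_3')$ are the multiexponents of $(\mathcal{A}^H,\mathbf{k})$, then $\mathcal{A}$ is free if and only if $$\chi(\mathcal{A},t)=(t-1)(t-d_2')(t-d_3').$$ -/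

import Mathlib

open Module Polynomial

noncomputable section

universe u v

/-- A (central) hyperplane arrangement in the vector space `V`: a finite collection of linear
subspaces of codimension one. -/
structure Arrangement (K : Type u) (V : Type v) [Field K] [AddCommGroup V] [Module K V] where
  hyperplanes : Finset (Submodule K V)
  codim_one : ∀ H ∈ hyperplanes, finrank K (V ⧸ H) = 1

/-- A multiarrangement: an arrangement with a multiplicity for each of its hyperplanes. -/
structure MultiArrangement (K : Type u) (V : Type v) [Field K] [AddCommGroup V] [Module K V]
    extends Arrangement K V where
  mult : {H // H ∈ hyperplanes} → ℕ

/-- The algebra `S = K[V^*]` of polynomial functions on `V` (for finite-dimensional `V`, the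
polynomial ring on any basis of `V^*`). -/
abbrev PolyFun (K : Type u) (V : Type v) [Field K] [AddCommGroup V] [Module K V] :
    Type (max u v) :=
  SymmetricAlgebra K (Dual K V)

section Basic

variable (K : Type u) (V : Type v) [Field K] [AddCommGroup V] [Module K V]

/-- A linear form on `V`, as an element of `S`. -/
abbrev linForm : Dual K V →ₗ[K] PolyFun K V := SymmetricAlgebra.ι K (Dual K V)

/-- The homogeneous part `S_d` of degree `d` of `S`: the span of the products of `d` linear
forms (the constants for `d = 0`). -/
def homogeneousPart (d : ℕ) : Submodule K (PolyFun K V) :=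
  LinearMap.range (linForm K V) ^ d

/-- The `S`-module `Der_V` of polynomial vector fields on `V`. -/
abbrev PolyVectorField : Type (max u v) := Derivation K (PolyFun K V) (PolyFun K V)

variable {K V}

/-- A polynomial vector field is homogeneous of degree `d` if its coefficients, i.e. its values
on linear forms, are homogeneous polynomials of degree `d` (so the Euler field has degree 1). -/
def PolyVectorField.IsHomogeneous (δ : PolyVectorField K V) (d : ℕ) : Prop :=
  ∀ α : Dual K V, δ (linForm K V α) ∈ homogeneousPart K V d

/-- The module `D(A, k)` of logarithmic vector fields: all `δ` such that `δ(α_H)` is divisible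
by `α_H ^ k(H)` for each hyperplane `H`. The condition does not depend on the linear form
`α_H` with kernel `H`, so it is imposed on all of them. -/
def MultiArrangement.logDer (A : MultiArrangement K V) :
    Submodule (PolyFun K V) (PolyVectorField K V) where
  carrier := {δ | ∀ (H : {H // H ∈ A.hyperplanes}) (α : Dual K V), LinearMap.ker α = H.1 →
    linForm K V α ^ A.mult H ∣ δ (linForm K V α)}
  zero_mem' := fun _ _ _ => dvd_zero _
  add_mem' := fun h₁ h₂ H α hα => dvd_add (h₁ H α hα) (h₂ H α hα)
  smul_mem' := fun f _ h H α hα => (h H α hα).mul_left f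

/-- A multiarrangement is free if `D(A, k)` is a free `S`-module. -/
def MultiArrangement.IsFree (A : MultiArrangement K V) : Prop :=
  Module.Free (PolyFun K V) A.logDer

/-- `e` is the multiset of degrees of a homogeneous basis of `D(A, k)`; that is, the
multiarrangement is free with multiexponents `e`. -/
def MultiArrangement.HasExponents (A : MultiArrangement K V) (e : Multiset ℕ) : Prop :=
  ∃ (n : ℕ) (b : Basis (Fin n) (PolyFun K V) A.logDer) (d : Fin n → ℕ),
    (∀ i, (b i : PolyVectorField K V).IsHomogeneous (d i)) ∧ Finset.univ.val.map d = e

namespace Arrangement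

/-- An arrangement, viewed as a multiarrangement with constant multiplicity one. -/
def toMulti (A : Arrangement K V) : MultiArrangement K V where
  toArrangement := A
  mult := fun _ => 1

/-- An arrangement is free if `D(A)` is a free `S`-module. -/
def IsFree (A : Arrangement K V) : Prop := A.toMulti.IsFree

/-- The restriction of a hyperplane `H' ≠ H` to a hyperplane `H` is a hyperplane of `H`. -/
theorem finrank_quotient_comap {H H' : Submodule K V} (hH : finrank K (V ⧸ H) = 1)
    (hH' : finrank K (V ⧸ H') = 1) (hne : H' ≠ H) :
    finrank K (H ⧸ H'.comap H.subtype) = 1 := by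
  have coatom : ∀ W : Submodule K V, finrank K (V ⧸ W) = 1 → IsCoatom W := by
    intro W hW
    rw [← isSimpleModule_iff_isCoatom]
    exact isSimpleModule_iff_finrank_eq_one.mpr hW
  have hsup : H ⊔ H' = ⊤ := (coatom H hH).sup_eq_top_of_ne (coatom H' hH') hne.symm
  let f : H →ₗ[K] V ⧸ H' := H'.mkQ ∘ₗ H.subtype
  have hker : LinearMap.ker f = H'.comap H.subtype := by
    rw [LinearMap.ker_comp, Submodule.ker_mkQ]
  have hsurj : Function.Surjective f := by
    intro q
    obtain ⟨v, rfl⟩ := H'.mkQ_surjective q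
    obtain ⟨x, hx, y, hy, rfl⟩ := Submodule.mem_sup.mp (hsup ▸ Submodule.mem_top : v ∈ H ⊔ H')
    refine ⟨⟨x, hx⟩, ?_⟩
    simp [f, (Submodule.Quotient.mk_eq_zero H').mpr hy]
  rw [← hker, (f.quotKerEquivOfSurjective hsurj).finrank_eq, hH']

open Classical in
/-- The restricted multiarrangement `(A^H, k)` on `H ∈ A`: its hyperplanes are the `H' ∩ H`
for `H' ∈ A`, `H' ≠ H`, and the multiplicity of `X` is the number of `H' ∈ A` with
`H' ∩ H = X`. -/
def restrict (A : Arrangement K V) (H : Submodule K V) (hH : H ∈ A.hyperplanes) :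
    MultiArrangement K H where
  hyperplanes := (A.hyperplanes.erase H).image fun H' => H'.comap H.subtype
  codim_one := by
    intro X hX
    obtain ⟨H', hH', rfl⟩ := Finset.mem_image.mp hX
    obtain ⟨hne, hmem⟩ := Finset.mem_erase.mp hH'
    exact finrank_quotient_comap (A.codim_one H hH) (A.codim_one H' hmem) hne
  mult := fun X => (A.hyperplanes.filter fun H' => H'.comap H.subtype = X.1).card

open Classical in
/-- The intersections of hyperplanes of `A`; the empty intersection is `V`. -/
def flats (A : Arrangement K V) : Finset (Submodule K V) :=
  A.hyperplanes.powerset.image fun B => B.inf id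

/-- The intersection lattice `L_A`, ordered by reverse inclusion. -/
abbrev IntersectionLattice (A : Arrangement K V) : Type v := {X // X ∈ A.flats}ᵒᵈ

open Classical in
instance locallyFiniteOrder (A : Arrangement K V) :
    LocallyFiniteOrder A.IntersectionLattice :=
  Fintype.toLocallyFiniteOrder

/-- The minimal element `V` of the intersection lattice. -/
def minFlat (A : Arrangement K V) : A.IntersectionLattice :=
  OrderDual.toDual ⟨⊤, Finset.mem_image.mpr ⟨∅, Finset.empty_mem_powerset _, rfl⟩⟩

open Classical in
/-- The Möbius function `μ(X) = μ(V, X)` of the intersection lattice. -/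
def moebius (A : Arrangement K V) (X : A.IntersectionLattice) : ℤ :=
  IncidenceAlgebra.mu ℤ A.minFlat X

/-- The characteristic polynomial `χ(A, t) = ∑_{X ∈ L_A} μ(X) t ^ dim X`. -/
def charPoly (A : Arrangement K V) : ℤ[X] :=
  ∑ F : A.IntersectionLattice, C (A.moebius F) * X ^ finrank K (OrderDual.ofDual F).1

end Arrangement

end Basic

end

/-! Write T for the arrangement without H, α for an equation of H, θ for the Euler field, and D₀ for
the fields tangent to T that kill α (`relFields`). Subtracting a multiple of θ moves any field of
D(A) into D₀, so D(A) = D₀ ⊕ Sθ (`mem_logFields_insert_iff`). Fields in D₀ restrict to H. The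
members of T through a line X of H have equations aγ + bα with a ≠ 0, and a field killing α has, up
to a unit, the same value at all of them; so all these equations divide φ(γ), and the restriction
lies in D(A^H, k). The kernel is αD₀ (`exists_of_restrictField_eq_zero`). Both conditions of the
theorem are equivalent to surjectivity of this restriction map D₀ → D(A^H, k).

Freeness. If the map is onto, lifts of a homogeneous basis form a basis of D₀ by a graded Nakayama
argument (`isPairBasis_relFields`), and θ completes it to a basis of D(A). Conversely, the map is
always onto in high degrees, and if D(A) is free, surjectivity descends from degree d + 1 to degree
d, because α and extensions of two independent forms on H are a regular sequence
(`imagePart_eq_of_succ`).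

Characteristic polynomial. By the exact sequence, dim (D₀)_d is the sum of the dimensions of the
images in degrees ≤ d. The dimensions of D(A^H, k) are known from the multiexponents, whose sum is
|T|. For d ≥ |A|, dim D(A)_d is a quadratic polynomial in d that involves only |A| and the sum b₂ of
the Möbius values of the one-dimensional flats (`finrank_logPart`). Comparison gives total
codimension b₂ - (d₂ + d₃ + d₂d₃) for the image (`sum_codim`). Its summands are nonnegative, so the
map is onto exactly when this number is 0. Since χ = t³ - |A|t² + b₂t - (1 - |A| + b₂) and d₂ + d₃ =
|A| - 1, that is the stated factorization.

The quadratic polynomial is found by adding hyperplanes one at a time: for φ tangent to T, the value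
φ(α) on H is a multiple of a fixed polynomial of degree |T| - |A^H| (`obstruction_dvd`), and in
large degrees all multiples occur (`obstruction_mul_mem`). Bases in the plane come from induction on
the total multiplicity (`exists_homogeneous_isPairBasis`). -/

noncomputable section

namespace PolyFun

variable {K V : Type*} [Field K] [AddCommGroup V] [Module K V]

/-! ### The grading of the algebra of polynomial functions -/

/-- The algebra homomorphism `S → S[X]` sending a linear form `α` to `α X`; its coefficients are
the homogeneous components. -/
def gradingHom : PolyFun K V →ₐ[K] (PolyFun K V)[X] :=
  SymmetricAlgebra.lift (((Polynomial.monomial 1).restrictScalars K) ∘ₗ linForm K V)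

@[simp] theorem gradingHom_linForm (α : Dual K V) :
    gradingHom (linForm K V α) = monomial 1 (linForm K V α) := by
  simp [gradingHom]

/-- The homogeneous component of degree `d`. -/
def comp (d : ℕ) : PolyFun K V →ₗ[K] PolyFun K V :=
  ((lcoeff (PolyFun K V) d).restrictScalars K) ∘ₗ gradingHom.toLinearMap

theorem comp_apply (d : ℕ) (f : PolyFun K V) : comp d f = (gradingHom f).coeff d := rfl

theorem linForm_mem (α : Dual K V) : linForm K V α ∈ homogeneousPart K V 1 := by
  simp [homogeneousPart]

theorem mul_mem {a b : ℕ} {f g : PolyFun K V} (hf : f ∈ homogeneousPart K V a)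
    (hg : g ∈ homogeneousPart K V b) : f * g ∈ homogeneousPart K V (a + b) := by
  rw [homogeneousPart, pow_add]
  exact Submodule.mul_mem_mul hf hg

theorem algebraMap_mem (r : K) : algebraMap K (PolyFun K V) r ∈ homogeneousPart K V 0 := by
  rw [homogeneousPart, pow_zero]
  exact Submodule.algebraMap_mem r

theorem one_mem : (1 : PolyFun K V) ∈ homogeneousPart K V 0 := by
  simpa using algebraMap_mem (V := V) (1 : K)

theorem pow_mem {a : ℕ} {f : PolyFun K V} (hf : f ∈ homogeneousPart K V a) (n : ℕ) :
    f ^ n ∈ homogeneousPart K V (n * a) := by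
  induction n with
  | zero => simpa using one_mem
  | succ n ih => rw [pow_succ, Nat.succ_mul]; exact mul_mem ih hf

theorem linForm_pow_mem (α : Dual K V) (n : ℕ) : linForm K V α ^ n ∈ homogeneousPart K V n := by
  simpa using pow_mem (linForm_mem α) n

theorem prod_mem {ι : Type*} (s : Finset ι) {f : ι → PolyFun K V} {d : ι → ℕ}
    (h : ∀ i ∈ s, f i ∈ homogeneousPart K V (d i)) :
    ∏ i ∈ s, f i ∈ homogeneousPart K V (∑ i ∈ s, d i) := by
  classical
  induction s using Finset.induction_on with
  | empty => simpa using one_mem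
  | insert a s ha ih =>
    rw [Finset.prod_insert ha, Finset.sum_insert ha]
    exact mul_mem (h a (by simp)) (ih fun i hi => h i (by simp [hi]))

theorem gradingHom_of_mem {d : ℕ} {f : PolyFun K V} (hf : f ∈ homogeneousPart K V d) :
    gradingHom f = monomial d f := by
  induction d generalizing f with
  | zero =>
    rw [homogeneousPart, pow_zero, Submodule.mem_one] at hf
    obtain ⟨r, rfl⟩ := hf
    rw [AlgHom.commutes, monomial_zero_left]
    rfl
  | succ d ih =>
    rw [homogeneousPart, pow_succ] at hf
    induction hf using Submodule.mul_induction_on' with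
    | mem_mul_mem m hm n hn =>
      obtain ⟨α, rfl⟩ := hn
      rw [map_mul, ih hm, gradingHom_linForm, monomial_mul_monomial]
    | add x _ y _ hx hy => rw [map_add, hx, hy, map_add]

theorem comp_mem (d : ℕ) (f : PolyFun K V) : comp d f ∈ homogeneousPart K V d := by
  induction f using SymmetricAlgebra.induction generalizing d with
  | algebraMap r =>
    rw [comp_apply, gradingHom_of_mem (algebraMap_mem r), coeff_monomial]
    split_ifs with h
    · rw [← h]; exact algebraMap_mem r
    · exact zero_mem _
  | ι α =>
    rw [comp_apply, gradingHom_of_mem (linForm_mem α), coeff_monomial]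
    split_ifs with h
    · rw [← h]; exact linForm_mem α
    · exact zero_mem _
  | mul a b ha hb =>
    rw [comp_apply, map_mul, coeff_mul]
    refine Submodule.sum_mem _ fun x hx => ?_
    rw [← Finset.HasAntidiagonal.mem_antidiagonal.mp hx]
    exact mul_mem (ha _) (hb _)
  | add a b ha hb => rw [map_add]; exact add_mem (ha d) (hb d)

theorem eval_one_gradingHom (f : PolyFun K V) : (gradingHom f).eval 1 = f := by
  induction f using SymmetricAlgebra.induction with
  | algebraMap r => rw [gradingHom_of_mem (algebraMap_mem r)]; simp
  | ι α => rw [gradingHom_of_mem (linForm_mem α)]; simp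
  | mul a b ha hb => rw [map_mul, eval_mul, ha, hb]
  | add a b ha hb => rw [map_add, eval_add, ha, hb]

theorem sum_comp (f : PolyFun K V) {N : ℕ} (hN : (gradingHom f).natDegree < N) :
    ∑ d ∈ Finset.range N, comp d f = f := by
  conv_rhs => rw [← eval_one_gradingHom f, eval_eq_sum_range' hN]
  simp [comp_apply]

theorem eq_zero_of_comp {f : PolyFun K V} (h : ∀ d, comp d f = 0) : f = 0 := by
  rw [← sum_comp f (Nat.lt_succ_self _)]
  exact Finset.sum_eq_zero fun d _ => h d

theorem comp_of_mem {d : ℕ} {f : PolyFun K V} (hf : f ∈ homogeneousPart K V d) :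
    comp d f = f := by
  rw [comp_apply, gradingHom_of_mem hf, coeff_monomial_same]

theorem comp_mul_add {e : ℕ} {g : PolyFun K V} (hg : g ∈ homogeneousPart K V e)
    (d : ℕ) (f : PolyFun K V) : comp (e + d) (g * f) = g * comp d f := by
  rw [comp_apply, map_mul, gradingHom_of_mem hg, add_comm, coeff_monomial_mul, comp_apply]

theorem comp_mul_of_lt {e d : ℕ} (h : d < e) {g : PolyFun K V} (hg : g ∈ homogeneousPart K V e)
    (f : PolyFun K V) : comp d (g * f) = 0 := by
  rw [comp_apply, map_mul, gradingHom_of_mem hg, ← C_mul_X_pow_eq_monomial, mul_assoc, coeff_C_mul,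
    coeff_X_pow_mul', if_neg (by omega), mul_zero]

theorem comp_of_mem_ne {d e : ℕ} (h : d ≠ e) {f : PolyFun K V}
    (hf : f ∈ homogeneousPart K V d) : comp e f = 0 := by
  rw [comp_apply, gradingHom_of_mem hf, coeff_monomial, if_neg h]

theorem dvd_comp {e : ℕ} {g f : PolyFun K V} (hg : g ∈ homogeneousPart K V e) (h : g ∣ f)
    (d : ℕ) : g ∣ comp d f := by
  obtain ⟨q, rfl⟩ := h
  rcases lt_or_ge d e with hd | hd
  · rw [comp_mul_of_lt hd hg]; exact dvd_zero _
  · obtain ⟨c, rfl⟩ := Nat.exists_eq_add_of_le hd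
    rw [comp_mul_add hg]; exact dvd_mul_right _ _

theorem mem_of_mul_mem {e d : ℕ} {g f : PolyFun K V} (hg : g ∈ homogeneousPart K V e)
    (h0 : g ≠ 0) (h : g * f ∈ homogeneousPart K V (e + d)) : f ∈ homogeneousPart K V d := by
  have h1 := comp_mul_add hg d f
  rw [comp_of_mem h] at h1
  rw [mul_left_cancel₀ h0 h1]
  exact comp_mem d f

theorem le_of_mul_mem {e d : ℕ} {g f : PolyFun K V} (hg : g ∈ homogeneousPart K V e)
    (h0 : g * f ≠ 0) (h : g * f ∈ homogeneousPart K V d) : e ≤ d := by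
  by_contra! hlt
  exact h0 ((comp_of_mem h).symm.trans (comp_mul_of_lt hlt hg f))

instance finiteDimensional_homogeneousPart [FiniteDimensional K V] (d : ℕ) :
    FiniteDimensional K (homogeneousPart K V d) :=
  Module.Finite.iff_fg.mpr (Submodule.FG.pow
    (Module.Finite.iff_fg.mp (inferInstance : Module.Finite K (LinearMap.range (linForm K V)))) d)

/-! ### Linear forms -/

theorem linForm_injective : Function.Injective (linForm K V) := by
  rw [injective_iff_map_eq_zero]
  intro α h
  ext v
  -- A linear form is recovered from its image in `S` by restricting polynomials to the line spanned
  -- by `v`: `F` extends to an algebra map `S → K[X]`.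
  let F : Dual K V →ₗ[K] K[X] := ((monomial 1 : K →ₗ[K] K[X]) ∘ₗ LinearMap.applyₗ v)
  have h1 : SymmetricAlgebra.lift F (linForm K V α) = F α := SymmetricAlgebra.lift_ι_apply _ _
  rw [h, map_zero] at h1
  simpa [F] using h1.symm

theorem linForm_ne_zero {α : Dual K V} (h : α ≠ 0) : linForm K V α ≠ 0 := by
  simpa using linForm_injective.ne h

theorem exists_smul_of_ker_le {α β : Dual K V} (h : LinearMap.ker α ≤ LinearMap.ker β) :
    ∃ c : K, β = c • α := by
  have := mem_span_of_iInf_ker_le_ker (ι := Unit) (L := fun _ => α) (K := β) (by simpa using h)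
  simp only [Set.range_const, Submodule.mem_span_singleton] at this
  obtain ⟨c, hc⟩ := this
  exact ⟨c, hc.symm⟩

/-! ### Restriction to a subspace -/

variable (H : Submodule K V)

/-- Restriction of polynomial functions to a subspace. -/
def res : PolyFun K V →ₐ[K] PolyFun K H :=
  SymmetricAlgebra.lift (linForm K H ∘ₗ H.subtype.dualMap)

@[simp] theorem res_linForm (α : Dual K V) :
    res H (linForm K V α) = linForm K H (H.subtype.dualMap α) := by
  simp [res]

/-- A linear extension of linear forms from a subspace. -/
def extendForm : Dual K H →ₗ[K] Dual K V :=
  (LinearMap.exists_leftInverse_of_injective H.subtype H.ker_subtype).choose.dualMap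

@[simp] theorem restrict_extendForm (β : Dual K H) :
    H.subtype.dualMap (extendForm H β) = β := by
  have h := (LinearMap.exists_leftInverse_of_injective H.subtype H.ker_subtype).choose_spec
  ext v
  exact congrArg β (LinearMap.congr_fun h v)

/-- The extension of polynomial functions determined by `extendForm`. -/
def extend : PolyFun K H →ₐ[K] PolyFun K V :=
  SymmetricAlgebra.lift (linForm K V ∘ₗ extendForm H)

@[simp] theorem extend_linForm (β : Dual K H) :
    extend H (linForm K H β) = linForm K V (extendForm H β) := by
  simp [extend]

@[simp] theorem res_extend (f : PolyFun K H) : res H (extend H f) = f := by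
  have : (res H).comp (extend H) = AlgHom.id K _ := by
    apply SymmetricAlgebra.algHom_ext
    ext β : 1
    change res H (extend H (linForm K H β)) = linForm K H β
    simp
  exact DFunLike.congr_fun this f

theorem map_mem_homogeneousPart {W : Type*} [AddCommGroup W] [Module K W]
    {F : PolyFun K V →ₐ[K] PolyFun K W}
    (hF : ∀ α, F (linForm K V α) ∈ LinearMap.range (linForm K W)) {d : ℕ} {f : PolyFun K V}
    (hf : f ∈ homogeneousPart K V d) : F f ∈ homogeneousPart K W d := by
  have h : (homogeneousPart K V d).map F.toLinearMap ≤ homogeneousPart K W d := by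
    rw [homogeneousPart, Submodule.map_pow]
    refine pow_le_pow_left' ?_ d
    rintro _ ⟨_, ⟨α, rfl⟩, rfl⟩
    exact hF α
  exact h ⟨f, hf, rfl⟩

theorem res_mem {d : ℕ} {f : PolyFun K V} (hf : f ∈ homogeneousPart K V d) :
    res H f ∈ homogeneousPart K H d :=
  map_mem_homogeneousPart (fun α => ⟨_, (res_linForm H α).symm⟩) hf

theorem extend_mem {d : ℕ} {f : PolyFun K H} (hf : f ∈ homogeneousPart K H d) :
    extend H f ∈ homogeneousPart K V d :=
  map_mem_homogeneousPart (fun α => ⟨_, (extend_linForm H α).symm⟩) hf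

theorem comp_res (d : ℕ) (f : PolyFun K V) : comp d (res H f) = res H (comp d f) := by
  conv_lhs => rw [← sum_comp f (Nat.lt_succ_of_le (le_max_left _ d))]
  rw [map_sum, map_sum, Finset.sum_eq_single d]
  · exact comp_of_mem (res_mem H (comp_mem d f))
  · intro e _ he
    exact comp_of_mem_ne he (res_mem H (comp_mem e f))
  · intro h
    exact absurd (Finset.mem_range.mpr (Nat.lt_succ_of_le (le_max_right _ d))) h

variable {H}

theorem restrict_eq_zero_iff {β : Dual K V} :
    H.subtype.dualMap β = 0 ↔ H ≤ LinearMap.ker β := by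
  constructor
  · intro h v hv
    exact LinearMap.congr_fun h ⟨v, hv⟩
  · intro h
    ext v
    exact h v.2

/-- On linear forms the difference vanishes on `H`, hence is a multiple of `α`; congruences modulo
`α` are stable under sums and products. This makes the kernel of `res H` the principal ideal of `α`.
-/
theorem dvd_sub_extend_res {α : Dual K V} (hα : LinearMap.ker α = H) (f : PolyFun K V) :
    linForm K V α ∣ f - extend H (res H f) := by
  induction f using SymmetricAlgebra.induction with
  | algebraMap r => simp
  | ι β =>
    change _ ∣ linForm K V β - extend H (res H (linForm K V β))
    rw [res_linForm, extend_linForm, ← map_sub]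
    have : LinearMap.ker α ≤ LinearMap.ker (β - extendForm H (H.subtype.dualMap β)) := by
      rw [hα, ← restrict_eq_zero_iff, map_sub, restrict_extendForm, sub_self]
    obtain ⟨c, hc⟩ := exists_smul_of_ker_le this
    rw [hc, map_smul, Algebra.smul_def]
    exact dvd_mul_left _ _
  | mul a b ha hb =>
    rw [map_mul, map_mul]
    have : a * b - extend H (res H a) * extend H (res H b) =
      (a - extend H (res H a)) * b + extend H (res H a) * (b - extend H (res H b)) := by ring
    rw [this]
    exact dvd_add (ha.mul_right _) (hb.mul_left _)
  | add a b ha hb =>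
    rw [map_add, map_add, add_sub_add_comm]
    exact dvd_add ha hb

theorem res_eq_zero_iff {α : Dual K V} (hα : LinearMap.ker α = H) {f : PolyFun K V} :
    res H f = 0 ↔ linForm K V α ∣ f := by
  constructor
  · intro h
    simpa [h] using dvd_sub_extend_res hα f
  · rintro ⟨g, rfl⟩
    rw [map_mul, res_linForm, restrict_eq_zero_iff.mpr hα.ge, map_zero, zero_mul]

/-- Divisibility by `α` is vanishing under `res (ker α)`, an algebra map to a domain. -/
theorem prime_linForm {α : Dual K V} (h : α ≠ 0) : Prime (linForm K V α) := by
  refine ⟨linForm_ne_zero h, fun hu => ?_, fun a b hab => ?_⟩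
  · have := hu.map (res (LinearMap.ker α))
    rw [(res_eq_zero_iff rfl).mpr dvd_rfl] at this
    exact not_isUnit_zero this
  · rw [← res_eq_zero_iff rfl, map_mul] at hab
    simpa [← res_eq_zero_iff (rfl : LinearMap.ker α = _)] using hab

theorem linForm_dvd_iff {α β : Dual K V} :
    linForm K V α ∣ linForm K V β ↔ LinearMap.ker α ≤ LinearMap.ker β := by
  rw [← res_eq_zero_iff rfl, res_linForm, map_eq_zero_iff _ linForm_injective,
    restrict_eq_zero_iff]

theorem prod_pow_dvd_of_prime {R ι : Type*} [CommRing R] [IsDomain R] (s : Finset ι) {p : ι → R}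
    (hp : ∀ i ∈ s, Prime (p i)) (hne : ∀ i ∈ s, ∀ j ∈ s, i ≠ j → ¬ p i ∣ p j) {k : ι → ℕ} {f : R}
    (hf : ∀ i ∈ s, p i ^ k i ∣ f) : ∏ i ∈ s, p i ^ k i ∣ f := by
  classical
  induction s using Finset.induction_on with
  | empty => simp
  | insert a s ha ih =>
    rw [Finset.prod_insert ha]
    obtain ⟨g, rfl⟩ := ih (fun i hi => hp i (by simp [hi]))
      (fun i hi j hj => hne i (by simp [hi]) j (by simp [hj])) (fun i hi => hf i (by simp [hi]))
    rw [mul_comm]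
    refine mul_dvd_mul_left _ ((hp a (by simp)).pow_dvd_of_dvd_mul_left _ ?_ (hf a (by simp)))
    rw [(hp a (by simp)).dvd_finsetProd_iff]
    rintro ⟨j, hj, hdvd⟩
    exact hne a (by simp) j (by simp [hj]) (fun h => ha (h ▸ hj))
      ((hp a (by simp)).dvd_of_dvd_pow hdvd)

/-! ### Dimensions of the homogeneous parts -/

theorem finrank_homogeneousPart_zero : finrank K (homogeneousPart K V 0) = 1 := by
  rw [homogeneousPart, pow_zero, Submodule.one_eq_span]
  exact finrank_span_singleton one_ne_zero

/-- Multiplication by `α` and restriction to its kernel form a short exact sequence 0 → S_d →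
S_{d+1} → K[ker α]_{d+1} → 0. -/
theorem finrank_homogeneousPart_succ [FiniteDimensional K V] {α : Dual K V} (h : α ≠ 0) (d : ℕ) :
    finrank K (homogeneousPart K V (d + 1)) =
      finrank K (homogeneousPart K V d) +
        finrank K (homogeneousPart K (LinearMap.ker α) (d + 1)) := by
  let f : homogeneousPart K V (d + 1) →ₗ[K] homogeneousPart K (LinearMap.ker α) (d + 1) :=
    (res (LinearMap.ker α)).toLinearMap.restrict fun _ hx => res_mem _ hx
  have hf : Function.Surjective f := fun y =>
    ⟨⟨_, extend_mem _ y.2⟩, Subtype.ext (res_extend _ _)⟩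
  let g : homogeneousPart K V d →ₗ[K] homogeneousPart K V (d + 1) :=
    (LinearMap.mulLeft K (linForm K V α)).restrict fun x hx => by
      rw [add_comm]; exact mul_mem (linForm_mem α) hx
  have hg : Function.Injective g := fun x y hxy =>
    Subtype.ext (mul_left_cancel₀ (linForm_ne_zero h) (congrArg Subtype.val hxy))
  have hk : LinearMap.ker f = LinearMap.range g := by
    ext x
    constructor
    · intro hx
      obtain ⟨y, hy⟩ := (res_eq_zero_iff rfl).mp (congrArg Subtype.val hx : res _ x.1 = 0)
      refine ⟨⟨y, mem_of_mul_mem (linForm_mem α) (linForm_ne_zero h) ?_⟩, Subtype.ext hy.symm⟩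
      rw [← hy, add_comm]; exact x.2
    · rintro ⟨y, rfl⟩
      exact Subtype.ext ((res_eq_zero_iff rfl).mpr (dvd_mul_right _ _))
  have := LinearMap.finrank_range_add_finrank_ker f
  rw [hk, LinearMap.finrank_range_of_inj hg, LinearMap.range_eq_top.mpr hf, finrank_top] at this
  omega

theorem finrank_ker_of_ne_zero [FiniteDimensional K V] {α : Dual K V} (h : α ≠ 0) :
    finrank K (LinearMap.ker α) + 1 = finrank K V := by
  have := LinearMap.finrank_range_add_finrank_ker α
  rw [LinearMap.range_eq_top.mpr (LinearMap.surjective h), finrank_top, finrank_self] at this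
  omega

theorem exists_dual_ne_zero (h : 0 < finrank K V) : ∃ α : Dual K V, α ≠ 0 := by
  have := nontrivial_of_finrank_pos h
  exact exists_ne 0

theorem homogeneousPart_eq_bot (h : Subsingleton V) (d : ℕ) :
    homogeneousPart K V (d + 1) = ⊥ := by
  have : LinearMap.range (linForm K V) = ⊥ := by
    rw [LinearMap.range_eq_bot]
    ext α : 1
    rw [Subsingleton.elim α 0]; simp
  rw [homogeneousPart, this, pow_succ, Submodule.mul_bot]

theorem finrank_homogeneousPart_of_finrank_one (hV : finrank K V = 1) (d : ℕ) :
    finrank K (homogeneousPart K V d) = 1 := by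
  have := FiniteDimensional.of_finrank_pos (hV ▸ one_pos)
  obtain ⟨α, hα⟩ := exists_dual_ne_zero (K := K) (V := V) (by omega)
  induction d with
  | zero => exact finrank_homogeneousPart_zero
  | succ d ih =>
    have hk := finrank_ker_of_ne_zero hα
    have hs : Subsingleton (LinearMap.ker α) := finrank_zero_iff (R := K).mp (by omega)
    rw [finrank_homogeneousPart_succ hα, ih, homogeneousPart_eq_bot hs, finrank_bot]

theorem finrank_homogeneousPart_of_finrank_two (hV : finrank K V = 2) (d : ℕ) :
    finrank K (homogeneousPart K V d) = d + 1 := by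
  have := FiniteDimensional.of_finrank_pos (K := K) (V := V) (by omega)
  obtain ⟨α, hα⟩ := exists_dual_ne_zero (K := K) (V := V) (by omega)
  have hk := finrank_ker_of_ne_zero hα
  induction d with
  | zero => exact finrank_homogeneousPart_zero
  | succ d ih =>
    rw [finrank_homogeneousPart_succ hα, ih, finrank_homogeneousPart_of_finrank_one (by omega)]

theorem finrank_homogeneousPart_of_finrank_three (hV : finrank K V = 3) (d : ℕ) :
    2 * finrank K (homogeneousPart K V d) = (d + 1) * (d + 2) := by
  have := FiniteDimensional.of_finrank_pos (K := K) (V := V) (by omega)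
  obtain ⟨α, hα⟩ := exists_dual_ne_zero (K := K) (V := V) (by omega)
  have hk := finrank_ker_of_ne_zero hα
  induction d with
  | zero => rw [finrank_homogeneousPart_zero]
  | succ d ih =>
    rw [finrank_homogeneousPart_succ hα, mul_add, ih,
      finrank_homogeneousPart_of_finrank_two (by omega)]
    ring

end PolyFun

end

noncomputable section

open PolyFun

variable {K V : Type*} [Field K] [AddCommGroup V] [Module K V]

/-! ### Vector fields as linear maps on linear forms -/

variable (K V) in
/-- A polynomial vector field, given by its values on linear forms. The Euler field is
`linForm K V`. -/
abbrev FormField : Type _ := Dual K V →ₗ[K] PolyFun K V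

namespace FormField

/-- The first order deformation of the identity of `S` along `φ`. -/
def deformation (φ : FormField K V) : PolyFun K V →ₐ[K] (PolyFun K V)[X] :=
  SymmetricAlgebra.lift (((Polynomial.monomial 0).restrictScalars K) ∘ₗ linForm K V +
    ((Polynomial.monomial 1).restrictScalars K) ∘ₗ φ)

@[simp] theorem deformation_linForm (φ : FormField K V) (α : Dual K V) :
    φ.deformation (linForm K V α) = monomial 0 (linForm K V α) + monomial 1 (φ α) := by
  simp [deformation]

/-- Setting `X = 0` in `α + φ(α) X` gives `α`. That the constant coefficient is the identity makes
the coefficient of `X` a derivation. -/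
theorem coeff_zero_deformation (φ : FormField K V) (f : PolyFun K V) :
    (φ.deformation f).coeff 0 = f := by
  induction f using SymmetricAlgebra.induction with
  | algebraMap r => rw [AlgHom.commutes]; exact coeff_C_zero
  | ι α =>
    change (φ.deformation (linForm K V α)).coeff 0 = linForm K V α
    simp [coeff_monomial]
  | mul a b ha hb => rw [map_mul, mul_coeff_zero, ha, hb]
  | add a b ha hb => rw [map_add, coeff_add, ha, hb]

/-- The derivation with given values on linear forms. -/
def toDerivation (φ : FormField K V) : PolyVectorField K V :=
  Derivation.mk' (((lcoeff (PolyFun K V) 1).restrictScalars K) ∘ₗ φ.deformation.toLinearMap)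
    fun a b => by
      change (φ.deformation (a * b)).coeff 1 =
        a * (φ.deformation b).coeff 1 + b * (φ.deformation a).coeff 1
      rw [map_mul, mul_coeff_one, coeff_zero_deformation, coeff_zero_deformation]
      ring

theorem toDerivation_linForm (φ : FormField K V) (α : Dual K V) :
    φ.toDerivation (linForm K V α) = φ α := by
  change (φ.deformation (linForm K V α)).coeff 1 = φ α
  simp

theorem _root_.PolyVectorField.ext_linForm {δ ε : PolyVectorField K V}
    (h : ∀ α, δ (linForm K V α) = ε (linForm K V α)) : δ = ε := by
  ext f
  induction f using SymmetricAlgebra.induction with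
  | algebraMap r => simp
  | ι α => exact h α
  | mul a b ha hb => rw [Derivation.leibniz, Derivation.leibniz, ha, hb]
  | add a b ha hb => rw [map_add, map_add, ha, hb]

variable (K V) in
/-- Polynomial vector fields correspond to linear maps on linear forms. -/
def derivationEquiv : PolyVectorField K V ≃ₗ[PolyFun K V] FormField K V where
  toFun δ := δ.toLinearMap ∘ₗ linForm K V
  map_add' _ _ := rfl
  map_smul' _ _ := rfl
  invFun := toDerivation
  left_inv _ := PolyVectorField.ext_linForm fun α => toDerivation_linForm _ α
  right_inv φ := LinearMap.ext fun α => toDerivation_linForm φ α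

@[simp] theorem derivationEquiv_apply (δ : PolyVectorField K V) (α : Dual K V) :
    derivationEquiv K V δ α = δ (linForm K V α) := rfl

variable (K V) in
/-- The vector fields that are homogeneous of degree `d`. -/
def homogeneous (d : ℕ) : Submodule K (FormField K V) where
  carrier := {φ | ∀ α, φ α ∈ homogeneousPart K V d}
  zero_mem' _ := zero_mem _
  add_mem' h₁ h₂ α := add_mem (h₁ α) (h₂ α)
  smul_mem' c _ h α := Submodule.smul_mem _ c (h α)

/-- The homogeneous component of degree `d` of a vector field. -/
def component (d : ℕ) (φ : FormField K V) : FormField K V := comp d ∘ₗ φ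

@[simp] theorem component_apply (d : ℕ) (φ : FormField K V) (α : Dual K V) :
    component d φ α = comp d (φ α) := rfl

theorem component_mem (d : ℕ) (φ : FormField K V) : component d φ ∈ homogeneous K V d :=
  fun _ => comp_mem _ _

theorem exists_sum_component [FiniteDimensional K V] (φ : FormField K V) :
    ∃ N, φ = ∑ d ∈ Finset.range N, component d φ := by
  let b := finBasis K (Dual K V)
  refine ⟨(Finset.univ.sup fun i => (gradingHom (φ (b i))).natDegree) + 1, b.ext fun i => ?_⟩
  rw [LinearMap.sum_apply]
  refine (PolyFun.sum_comp _ (Nat.lt_succ_of_le ?_)).symm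
  exact Finset.le_sup (f := fun i => (gradingHom (φ (b i))).natDegree) (Finset.mem_univ i)

theorem smul_mem_homogeneous {a b : ℕ} {f : PolyFun K V} {φ : FormField K V}
    (hf : f ∈ homogeneousPart K V a) (hφ : φ ∈ homogeneous K V b) :
    f • φ ∈ homogeneous K V (a + b) :=
  fun α => mul_mem hf (hφ α)

theorem linForm_mem_homogeneous : linForm K V ∈ homogeneous K V 1 := linForm_mem

variable (K) in
/-- The constant vector field in the direction `v`. -/
def const (v : V) : FormField K V := Algebra.linearMap K (PolyFun K V) ∘ₗ LinearMap.applyₗ v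

@[simp] theorem const_apply (v : V) (α : Dual K V) :
    const K v α = algebraMap K (PolyFun K V) (α v) := rfl

theorem const_mem_homogeneous (v : V) : const K v ∈ homogeneous K V 0 :=
  fun _ => algebraMap_mem _

/-- The space of fields that are homogeneous of degree `d` is `Hom(V^*, S_d)`. -/
def homogeneousEquiv (d : ℕ) :
    homogeneous K V d ≃ₗ[K] (Dual K V →ₗ[K] homogeneousPart K V d) where
  toFun φ := LinearMap.codRestrict _ φ.1 φ.2
  map_add' _ _ := rfl
  map_smul' _ _ := rfl
  invFun ψ := ⟨(homogeneousPart K V d).subtype ∘ₗ ψ, fun α => (ψ α).2⟩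
  left_inv _ := rfl
  right_inv _ := rfl

instance [FiniteDimensional K V] (d : ℕ) : FiniteDimensional K (homogeneous K V d) :=
  Module.Finite.equiv (homogeneousEquiv d).symm

theorem finrank_homogeneous [FiniteDimensional K V] (d : ℕ) :
    finrank K (homogeneous K V d) = finrank K V * finrank K (homogeneousPart K V d) := by
  rw [(homogeneousEquiv d).finrank_eq, finrank_linearMap, Subspace.dual_finrank_eq]

end FormField

open FormField

/-! ### Equations of hyperplanes -/

theorem exists_form_of_finrank_quotient {H : Submodule K V} (h : finrank K (V ⧸ H) = 1) :
    ∃ α : Dual K V, LinearMap.ker α = H := by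
  have := FiniteDimensional.of_finrank_pos (h ▸ one_pos)
  let e : (V ⧸ H) ≃ₗ[K] K := LinearEquiv.ofFinrankEq _ _ (by rw [h, finrank_self])
  exact ⟨e.toLinearMap ∘ₗ H.mkQ, by rw [LinearEquiv.ker_comp, Submodule.ker_mkQ]⟩

open Classical in
/-- A linear form with kernel `H`, if there is one. -/
def form (H : Submodule K V) : Dual K V :=
  if h : finrank K (V ⧸ H) = 1 then (exists_form_of_finrank_quotient h).choose else 0

theorem ker_form {H : Submodule K V} (h : finrank K (V ⧸ H) = 1) :
    LinearMap.ker (form H) = H := by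
  rw [form, dif_pos h]
  exact (exists_form_of_finrank_quotient h).choose_spec

theorem ne_zero_of_ker_eq {H : Submodule K V} (h : finrank K (V ⧸ H) = 1) {α : Dual K V}
    (hα : LinearMap.ker α = H) : α ≠ 0 := by
  rintro rfl
  rw [LinearMap.ker_zero] at hα
  subst hα
  rw [finrank_zero_iff.mpr inferInstance] at h
  exact zero_ne_one h

theorem form_ne_zero {H : Submodule K V} (h : finrank K (V ⧸ H) = 1) : form H ≠ 0 :=
  ne_zero_of_ker_eq h (ker_form h)

theorem eq_of_ker_le_ker {α β : Dual K V} (hβ : β ≠ 0)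
    (h : LinearMap.ker α ≤ LinearMap.ker β) : LinearMap.ker α = LinearMap.ker β := by
  obtain ⟨c, rfl⟩ := exists_smul_of_ker_le h
  have hc : c ≠ 0 := by rintro rfl; simp at hβ
  rw [LinearMap.ker_smul _ _ hc]

theorem eq_of_hyperplane_le {H H' : Submodule K V} (h : finrank K (V ⧸ H) = 1)
    (h' : finrank K (V ⧸ H') = 1) (hle : H ≤ H') : H = H' := by
  rw [← ker_form h, ← ker_form h'] at hle ⊢
  exact eq_of_ker_le_ker (form_ne_zero h') hle

theorem form_not_dvd {H H' : Submodule K V} (h : finrank K (V ⧸ H) = 1)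
    (h' : finrank K (V ⧸ H') = 1) (hne : H ≠ H') :
    ¬ linForm K V (form H) ∣ linForm K V (form H') := by
  rw [linForm_dvd_iff, ker_form h, ker_form h']
  exact fun hle => hne (eq_of_hyperplane_le h h' hle)

theorem prime_form {H : Submodule K V} (h : finrank K (V ⧸ H) = 1) :
    Prime (linForm K V (form H)) := prime_linForm (form_ne_zero h)

/-! ### Logarithmic vector fields -/

/-- The vector fields `φ` such that `φ(α_H)` is divisible by `α_H ^ m(H)` for `H ∈ T`. -/
def logFields (T : Finset (Submodule K V)) (m : Submodule K V → ℕ) :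
    Submodule (PolyFun K V) (FormField K V) where
  carrier := {φ | ∀ H ∈ T, ∀ α : Dual K V, LinearMap.ker α = H →
    linForm K V α ^ m H ∣ φ α}
  zero_mem' := fun _ _ _ _ => dvd_zero _
  add_mem' := fun h₁ h₂ H hH α hα => dvd_add (h₁ H hH α hα) (h₂ H hH α hα)
  smul_mem' := fun f _ h H hH α hα => (h H hH α hα).mul_left f

theorem logFields_congr {T : Finset (Submodule K V)} {m m' : Submodule K V → ℕ}
    (h : ∀ H ∈ T, m H = m' H) : logFields T m = logFields T m' := by
  ext φ
  exact forall₂_congr fun H hH => by rw [h H hH]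

theorem pow_dvd_apply_of_ker_eq {φ : FormField K V} {α β : Dual K V}
    (h : LinearMap.ker α = LinearMap.ker β) {k : ℕ} (hα : linForm K V α ^ k ∣ φ α) :
    linForm K V β ^ k ∣ φ β := by
  obtain ⟨c, rfl⟩ := exists_smul_of_ker_le h.ge
  rcases eq_or_ne c 0 with rfl | hc
  · have hβ : β = 0 := by
      rw [← LinearMap.ker_eq_top, ← h, zero_smul, LinearMap.ker_zero]
    simp [hβ]
  · rw [map_smul, map_smul, _root_.smul_pow] at hα
    rw [Algebra.smul_def, Algebra.smul_def] at hα
    have hu : ∀ x : K, x ≠ 0 → IsUnit (algebraMap K (PolyFun K V) x) := fun x hx =>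
      (IsUnit.mk0 x hx).map _
    rwa [(hu _ (pow_ne_zero k hc)).mul_left_dvd, (hu _ hc).dvd_mul_left] at hα

theorem mem_logFields_iff_form {T : Finset (Submodule K V)} {m : Submodule K V → ℕ}
    (hT : ∀ H ∈ T, finrank K (V ⧸ H) = 1) {φ : FormField K V} :
    φ ∈ logFields T m ↔ ∀ H ∈ T, linForm K V (form H) ^ m H ∣ φ (form H) :=
  ⟨fun h H hH => h H hH _ (ker_form (hT H hH)), fun h H hH _ hα =>
    pow_dvd_apply_of_ker_eq ((ker_form (hT H hH)).trans hα.symm) (h H hH)⟩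

theorem component_mem_logFields {T : Finset (Submodule K V)} {m : Submodule K V → ℕ}
    {φ : FormField K V} (h : φ ∈ logFields T m) (d : ℕ) : component d φ ∈ logFields T m :=
  fun H hH α hα => dvd_comp (linForm_pow_mem α (m H)) (h H hH α hα) d

theorem linForm_mem_logFields (T : Finset (Submodule K V)) :
    linForm K V ∈ logFields T fun _ => 1 :=
  fun _ _ α _ => by rw [pow_one]

/-- The space of logarithmic vector fields that are homogeneous of degree `d`. -/
def logPart (T : Finset (Submodule K V)) (m : Submodule K V → ℕ) (d : ℕ) :
    Submodule K (FormField K V) :=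
  (logFields T m).restrictScalars K ⊓ homogeneous K V d

theorem mem_logPart {T : Finset (Submodule K V)} {m : Submodule K V → ℕ} {d : ℕ}
    {φ : FormField K V} : φ ∈ logPart T m d ↔ φ ∈ logFields T m ∧ φ ∈ homogeneous K V d :=
  Iff.rfl

instance [FiniteDimensional K V] (T : Finset (Submodule K V)) (m : Submodule K V → ℕ) (d : ℕ) :
    FiniteDimensional K (logPart T m d) :=
  Submodule.finiteDimensional_of_le (inf_le_right : _ ≤ homogeneous K V d)

namespace MultiArrangement

open Classical in
/-- The multiplicities of a multiarrangement, extended by zero. -/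
def multFun (A : MultiArrangement K V) (H : Submodule K V) : ℕ :=
  if h : H ∈ A.hyperplanes then A.mult ⟨H, h⟩ else 0

theorem derivationEquiv_mem_iff (A : MultiArrangement K V) (δ : PolyVectorField K V) :
    derivationEquiv K V δ ∈ logFields A.hyperplanes A.multFun ↔ δ ∈ A.logDer := by
  constructor
  · intro h H α hα
    have := h H.1 H.2 α hα
    rwa [multFun, dif_pos H.2] at this
  · intro h H hH α hα
    rw [multFun, dif_pos hH]
    exact h ⟨H, hH⟩ α hα

/-- Logarithmic derivations and logarithmic vector fields correspond. -/
def logDerEquiv (A : MultiArrangement K V) :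
    A.logDer ≃ₗ[PolyFun K V] logFields A.hyperplanes A.multFun :=
  (derivationEquiv K V).ofSubmodules _ _ <| by
    ext φ
    rw [Submodule.mem_map_equiv, ← A.derivationEquiv_mem_iff, LinearEquiv.apply_symm_apply]

theorem logDerEquiv_apply (A : MultiArrangement K V) (δ : A.logDer) :
    (A.logDerEquiv δ : FormField K V) = derivationEquiv K V δ := rfl

end MultiArrangement

theorem Arrangement.isFree_iff (A : Arrangement K V) :
    A.IsFree ↔ Module.Free (PolyFun K V) (logFields A.hyperplanes fun _ => 1) := by
  have h : logFields A.hyperplanes (fun _ => 1) =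
      logFields A.toMulti.hyperplanes A.toMulti.multFun :=
    logFields_congr fun H hH => by
      rw [MultiArrangement.multFun, dif_pos (show H ∈ A.toMulti.hyperplanes from hH)]; rfl
  rw [h]
  exact ⟨fun hf => Module.Free.of_equiv' hf A.toMulti.logDerEquiv,
    fun hf => Module.Free.of_equiv' hf A.toMulti.logDerEquiv.symm⟩

/-! ### Modules with a basis of two elements -/

/-- The pair `θ₁, θ₂` is a basis of the module `D`. -/
structure IsPairBasis {R M : Type*} [CommRing R] [AddCommGroup M] [Module R M]
    (D : Submodule R M) (θ₁ θ₂ : M) : Prop where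
  mem_iff : ∀ φ, φ ∈ D ↔ ∃ f g : R, φ = f • θ₁ + g • θ₂
  indep : ∀ f g : R, f • θ₁ + g • θ₂ = 0 → f = 0 ∧ g = 0

namespace IsPairBasis

variable {R M : Type*} [CommRing R] [AddCommGroup M] [Module R M] {D : Submodule R M} {θ₁ θ₂ : M}

theorem left_mem (h : IsPairBasis D θ₁ θ₂) : θ₁ ∈ D := (h.mem_iff _).mpr ⟨1, 0, by simp⟩

theorem right_mem (h : IsPairBasis D θ₁ θ₂) : θ₂ ∈ D := (h.mem_iff _).mpr ⟨0, 1, by simp⟩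

theorem symm (h : IsPairBasis D θ₁ θ₂) : IsPairBasis D θ₂ θ₁ where
  mem_iff φ := by
    rw [h.mem_iff]
    exact ⟨fun ⟨f, g, e⟩ => ⟨g, f, by rw [e, add_comm]⟩,
      fun ⟨f, g, e⟩ => ⟨g, f, by rw [e, add_comm]⟩⟩
  indep f g e := (h.indep g f (by rw [add_comm, e])).symm

/-- The coordinates with respect to a pair of basis elements. -/
def equiv (h : IsPairBasis D θ₁ θ₂) : (Fin 2 → R) ≃ₗ[R] D :=
  LinearEquiv.ofBijective
    (((LinearMap.proj 0).smulRight (⟨θ₁, h.left_mem⟩ : D) +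
      (LinearMap.proj 1).smulRight (⟨θ₂, h.right_mem⟩ : D) : (Fin 2 → R) →ₗ[R] D)) <| by
    constructor
    · rw [← LinearMap.ker_eq_bot, LinearMap.ker_eq_bot']
      intro c hc
      have := h.indep (c 0) (c 1) (congrArg Subtype.val hc)
      ext i
      fin_cases i
      · exact this.1
      · exact this.2
    · rintro ⟨φ, hφ⟩
      obtain ⟨f, g, rfl⟩ := (h.mem_iff φ).mp hφ
      exact ⟨![f, g], Subtype.ext (by simp)⟩

theorem equiv_apply (h : IsPairBasis D θ₁ θ₂) (c : Fin 2 → R) :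
    (h.equiv c : M) = c 0 • θ₁ + c 1 • θ₂ := rfl

/-- The basis given by a pair of basis elements. -/
def basis (h : IsPairBasis D θ₁ θ₂) : Basis (Fin 2) R D := Basis.ofEquivFun h.equiv.symm

theorem coe_basis (h : IsPairBasis D θ₁ θ₂) (i : Fin 2) : (h.basis i : M) = ![θ₁, θ₂] i := by
  rw [basis, Basis.coe_ofEquivFun, LinearEquiv.symm_symm, equiv_apply]
  fin_cases i <;> simp

theorem of_basis (b : Basis (Fin 2) R D) : IsPairBasis D (b 0 : M) (b 1) where
  mem_iff φ := by
    constructor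
    · intro hφ
      have := b.sum_repr ⟨φ, hφ⟩
      rw [Fin.sum_univ_two] at this
      exact ⟨_, _, (congrArg Subtype.val this).symm⟩
    · rintro ⟨f, g, rfl⟩
      exact add_mem (D.smul_mem _ (b 0).2) (D.smul_mem _ (b 1).2)
  indep f g h := by
    have h' : f • b 0 + g • b 1 = 0 := Subtype.ext h
    have := Fintype.linearIndependent_iff.mp b.linearIndependent ![f, g]
      (by rw [Fin.sum_univ_two]; exact h')
    exact ⟨this 0, this 1⟩

end IsPairBasis

theorem MultiArrangement.hasExponents_pair_iff (A : MultiArrangement K V) (d₁ d₂ : ℕ) :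
    A.HasExponents {d₁, d₂} ↔ ∃ θ₁ ∈ homogeneous K V d₁, ∃ θ₂ ∈ homogeneous K V d₂,
      IsPairBasis (logFields A.hyperplanes A.multFun) θ₁ θ₂ := by
  constructor
  · rintro ⟨n, b, d, hb, hd⟩
    have hn : n = 2 := by simpa using congrArg Multiset.card hd
    subst hn
    have hd' : ({d 0, d 1} : Multiset ℕ) = {d₁, d₂} := by
      rw [← hd]; rfl
    have hθ (i : Fin 2) :
        (b.map A.logDerEquiv i : FormField K V) ∈ homogeneous K V (d i) := by
      rw [Basis.map_apply, A.logDerEquiv_apply]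
      exact hb i
    have hbasis := IsPairBasis.of_basis (b.map A.logDerEquiv)
    -- The multiset of degrees is unordered, so the two basis elements may have to be swapped.
    have hcases : d 0 = d₁ ∧ d 1 = d₂ ∨ d 0 = d₂ ∧ d 1 = d₁ := by
      rcases Multiset.cons_eq_cons.mp hd' with ⟨h0, h1⟩ | ⟨_, cs, h0, h1⟩
      · exact Or.inl ⟨h0, Multiset.singleton_inj.mp h1⟩
      · have hcs : cs = 0 := by simpa using congrArg Multiset.card h0
        subst hcs
        exact Or.inr ⟨(Multiset.singleton_inj.mp h1).symm, Multiset.singleton_inj.mp h0⟩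
    rcases hcases with ⟨h0, h1⟩ | ⟨h0, h1⟩
    · exact ⟨_, h0 ▸ hθ 0, _, h1 ▸ hθ 1, hbasis⟩
    · exact ⟨_, h1 ▸ hθ 1, _, h0 ▸ hθ 0, hbasis.symm⟩
  · rintro ⟨θ₁, h₁, θ₂, h₂, hb⟩
    refine ⟨2, hb.basis.map A.logDerEquiv.symm, ![d₁, d₂], fun i α => ?_, rfl⟩
    rw [← derivationEquiv_apply, ← A.logDerEquiv_apply, Basis.map_apply,
      LinearEquiv.apply_symm_apply, hb.coe_basis]
    fin_cases i
    · exact h₁ α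
    · exact h₂ α

end

noncomputable section

open PolyFun FormField

/-! ### Multiarrangements of lines in a plane -/

namespace IsPairBasis

variable {R M : Type*} [CommRing R] [AddCommGroup M] [Module R M] {D D' : Submodule R M}
  {θ₁ θ₂ : M}

theorem sub_smul (h : IsPairBasis D θ₁ θ₂) (s : R) : IsPairBasis D (θ₁ - s • θ₂) θ₂ where
  mem_iff φ := by
    rw [h.mem_iff]
    constructor
    · rintro ⟨f, g, rfl⟩
      exact ⟨f, g + f * s, by module⟩
    · rintro ⟨f, g, rfl⟩
      exact ⟨f, g - f * s, by module⟩
  indep f g e := by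
    obtain ⟨h1, h2⟩ := h.indep f (g - f * s) (by rw [← e]; module)
    exact ⟨h1, by simpa [h1] using h2⟩

/-- The condition modulo `p ^ (k + 1)` constrains only the coefficient of `θ₂`; as `ev θ₂` is
divisible by `p` exactly `k` times, that coefficient must be a multiple of `p`. This is one step of
raising a multiplicity. -/
theorem smul_of_prime_pow [IsDomain R] (h : IsPairBasis D' θ₁ θ₂) {p : R} (hp : Prime p) {k : ℕ}
    (ev : M →ₗ[R] R) (hD : ∀ φ, φ ∈ D ↔ φ ∈ D' ∧ p ^ (k + 1) ∣ ev φ)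
    (h₁ : p ^ (k + 1) ∣ ev θ₁) (h₂ : p ^ k ∣ ev θ₂) (h₂' : ¬ p ^ (k + 1) ∣ ev θ₂) :
    IsPairBasis D θ₁ (p • θ₂) where
  mem_iff φ := by
    rw [hD]
    constructor
    · rintro ⟨hφ, hdvd⟩
      obtain ⟨f, g, rfl⟩ := (h.mem_iff φ).mp hφ
      obtain ⟨q, hq⟩ := h₂
      rw [map_add, map_smul, map_smul, smul_eq_mul, smul_eq_mul,
        dvd_add_right (h₁.mul_left f), hq, mul_left_comm, pow_succ,
        mul_dvd_mul_iff_left (pow_ne_zero k hp.ne_zero)] at hdvd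
      have hpq : ¬ p ∣ q := by
        intro hpq
        rw [hq, pow_succ] at h₂'
        exact h₂' (mul_dvd_mul_left _ hpq)
      obtain ⟨g', rfl⟩ := (hp.dvd_or_dvd hdvd).resolve_right hpq
      exact ⟨f, g', by module⟩
    · rintro ⟨f, g, rfl⟩
      refine ⟨(h.mem_iff _).mpr ⟨f, g * p, by module⟩, ?_⟩
      rw [map_add, map_smul, map_smul, map_smul, smul_eq_mul, smul_eq_mul, smul_eq_mul, pow_succ]
      rw [pow_succ] at h₁
      refine dvd_add (h₁.mul_left f) (Dvd.dvd.mul_left ?_ g)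
      rw [mul_comm p]
      exact mul_dvd_mul_right h₂ p
  indep f g e := by
    obtain ⟨h1, h2⟩ := h.indep f (g * p) (by rw [← e]; module)
    exact ⟨h1, (mul_eq_zero.mp h2).resolve_right hp.ne_zero⟩

end IsPairBasis

variable {K V : Type*} [Field K] [AddCommGroup V] [Module K V]

/-- On a line all homogeneous parts have dimension one, so multiplication by `g ≠ 0` is bijective
between them. -/
theorem PolyFun.exists_eq_mul_of_finrank_one (hV : finrank K V = 1) {a e : ℕ} {f g : PolyFun K V}
    (hg : g ∈ homogeneousPart K V a) (h0 : g ≠ 0) (hf : f ∈ homogeneousPart K V (a + e)) :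
    ∃ c ∈ homogeneousPart K V e, f = g * c := by
  have := FiniteDimensional.of_finrank_pos (hV ▸ one_pos)
  let F : homogeneousPart K V e →ₗ[K] homogeneousPart K V (a + e) :=
    (LinearMap.mulLeft K g).restrict fun x hx => mul_mem hg hx
  have hF : Function.Injective F := fun x y hxy =>
    Subtype.ext (mul_left_cancel₀ h0 (congrArg Subtype.val hxy))
  rw [LinearMap.injective_iff_surjective_of_finrank_eq_finrank (by
    rw [finrank_homogeneousPart_of_finrank_one hV,
      finrank_homogeneousPart_of_finrank_one hV])] at hF
  obtain ⟨c, hc⟩ := hF ⟨f, hf⟩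
  exact ⟨c.1, c.2, (congrArg Subtype.val hc).symm⟩

/-- Evaluation of a vector field at a linear form. -/
def FormField.eval (α : Dual K V) : FormField K V →ₗ[PolyFun K V] PolyFun K V where
  toFun φ := φ α
  map_add' _ _ := rfl
  map_smul' _ _ := rfl

/-- After cancelling `α ^ k` in both polynomials, the quotients need only be matched on the line
`H`. There the second quotient is nonzero of no larger degree, so it divides the first; `s` extends
the ratio to the plane. -/
theorem exists_pow_succ_dvd_sub {H : Submodule K V} (hV : finrank K V = 2)
    (hH : finrank K (V ⧸ H) = 1) {k d₁ d₂ : ℕ} (hd : d₂ ≤ d₁) {f₁ f₂ : PolyFun K V}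
    (hf₁ : f₁ ∈ homogeneousPart K V d₁) (hf₂ : f₂ ∈ homogeneousPart K V d₂)
    (h₁ : linForm K V (form H) ^ k ∣ f₁) (h₂ : linForm K V (form H) ^ k ∣ f₂)
    (h₂' : ¬ linForm K V (form H) ^ (k + 1) ∣ f₂) :
    ∃ s ∈ homogeneousPart K V (d₁ - d₂),
      linForm K V (form H) ^ (k + 1) ∣ f₁ - s * f₂ := by
  have := FiniteDimensional.of_finrank_pos (K := K) (V := V) (by omega)
  have hp := prime_form hH
  have hpk := pow_ne_zero k hp.ne_zero
  have hHrank : finrank K H = 1 := by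
    have := H.finrank_quotient_add_finrank
    omega
  obtain ⟨q₁, rfl⟩ := h₁
  obtain ⟨q₂, rfl⟩ := h₂
  rw [pow_succ, mul_dvd_mul_iff_left hpk, ← res_eq_zero_iff (ker_form hH)] at h₂'
  have hne : linForm K V (form H) ^ k * q₂ ≠ 0 := mul_ne_zero hpk (by rintro rfl; simp at h₂')
  obtain ⟨e₂, rfl⟩ := Nat.exists_eq_add_of_le (le_of_mul_mem (linForm_pow_mem _ k) hne hf₂)
  obtain ⟨e, rfl⟩ := Nat.exists_eq_add_of_le hd
  have hq₂ := mem_of_mul_mem (linForm_pow_mem _ k) hpk hf₂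
  rw [add_assoc] at hf₁
  have hq₁ := mem_of_mul_mem (linForm_pow_mem _ k) hpk hf₁
  obtain ⟨c, hc, hc'⟩ := exists_eq_mul_of_finrank_one hHrank (res_mem H hq₂) h₂' (res_mem H hq₁)
  refine ⟨extend H c, by simpa using extend_mem H hc, ?_⟩
  have : linForm K V (form H) ^ k * q₁ - extend H c * (linForm K V (form H) ^ k * q₂) =
    linForm K V (form H) ^ k * (q₁ - extend H c * q₂) := by ring
  rw [this, pow_succ, mul_dvd_mul_iff_left hpk, ← res_eq_zero_iff (ker_form hH), map_sub, map_mul,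
    res_extend, hc', mul_comm c, sub_self]

/-- The witness is the product of all `α_{H'} ^ m(H')` times the constant field along some `v` with
`α_H(v) = 1`. It shows that two generators of the module cannot both satisfy the condition for the
next power of `α_H`. -/
theorem exists_mem_logFields_not_dvd {T : Finset (Submodule K V)}
    (hT : ∀ H ∈ T, finrank K (V ⧸ H) = 1) (m : Submodule K V → ℕ) {H : Submodule K V}
    (hH : H ∈ T) :
    ∃ φ ∈ logFields T m, ¬ linForm K V (form H) ^ (m H + 1) ∣ φ (form H) := by
  classical
  obtain ⟨v, hv⟩ := LinearMap.surjective (form_ne_zero (hT H hH)) 1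
  have hp := prime_form (hT H hH)
  refine ⟨(∏ H' ∈ T, linForm K V (form H') ^ m H') • const K v, ?_, ?_⟩
  · rw [mem_logFields_iff_form hT]
    intro H' hH'
    exact (Finset.dvd_prod_of_mem (fun H' => linForm K V (form H') ^ m H') hH').mul_right _
  · rw [LinearMap.smul_apply, const_apply, hv, map_one, smul_eq_mul, mul_one,
      ← Finset.mul_prod_erase _ _ hH, pow_succ,
      mul_dvd_mul_iff_left (pow_ne_zero _ hp.ne_zero), hp.dvd_finsetProd_iff]
    rintro ⟨H', hH', hdvd⟩
    rw [Finset.mem_erase] at hH'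
    exact form_not_dvd (hT H hH) (hT H' hH'.2) hH'.1.symm (hp.dvd_of_dvd_pow hdvd)

theorem isPairBasis_const (b : Basis (Fin 2) K V) :
    IsPairBasis (⊤ : Submodule (PolyFun K V) (FormField K V)) (const K (b 0)) (const K (b 1)) where
  mem_iff φ := by
    refine ⟨fun _ => ⟨φ (b.coord 0), φ (b.coord 1), ?_⟩, fun _ => trivial⟩
    refine b.dualBasis.ext fun i => ?_
    fin_cases i <;> simp [Basis.coe_dualBasis]
  indep f g e := by
    have h0 := LinearMap.congr_fun e (b.coord 0)
    have h1 := LinearMap.congr_fun e (b.coord 1)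
    simp at h0 h1
    exact ⟨h0, h1⟩

/-- A multiarrangement in a plane is free, and its multiexponents sum up to the total
multiplicity. -/
theorem exists_homogeneous_isPairBasis (hV : finrank K V = 2) {T : Finset (Submodule K V)}
    (hT : ∀ H ∈ T, finrank K (V ⧸ H) = 1) (m : Submodule K V → ℕ) :
    ∃ d₁ d₂ : ℕ, d₁ + d₂ = ∑ H ∈ T, m H ∧ ∃ θ₁ ∈ homogeneous K V d₁, ∃ θ₂ ∈ homogeneous K V d₂,
      IsPairBasis (logFields T m) θ₁ θ₂ := by
  classical
  have := FiniteDimensional.of_finrank_pos (K := K) (V := V) (by omega)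
  generalize hN : ∑ H ∈ T, m H = N
  induction N generalizing m with
  | zero =>
    rw [Finset.sum_eq_zero_iff] at hN
    have htop : logFields T m = ⊤ := by
      rw [eq_top_iff]
      intro φ _ H hH α _
      rw [hN H hH, pow_zero]
      exact one_dvd _
    rw [htop]
    exact ⟨0, 0, rfl, _, const_mem_homogeneous _, _, const_mem_homogeneous _,
      isPairBasis_const (finBasisOfFinrankEq K V hV)⟩
  | succ N ih =>
    obtain ⟨H, hH, hmH⟩ : ∃ H ∈ T, m H ≠ 0 := by
      by_contra! h
      rw [Finset.sum_eq_zero h] at hN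
      omega
    obtain ⟨k, hk⟩ := Nat.exists_eq_succ_of_ne_zero hmH
    -- Lower the multiplicity of `H` by one; a basis for `m'` will be modified to one for `m`.
    let m' := Function.update m H k
    have hm'H : m' H = k := Function.update_self ..
    have hm' : ∀ H' ≠ H, m' H' = m H' := fun H' h => Function.update_of_ne h ..
    have hsum : ∑ H' ∈ T, m' H' = N := by
      rw [← Finset.add_sum_erase _ _ hH] at hN ⊢
      rw [hk] at hN
      rw [hm'H, Finset.sum_congr rfl fun H' h => hm' H' (Finset.ne_of_mem_erase h)]
      change k + ∑ x ∈ T.erase H, m x = N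
      omega
    have hp := prime_form (hT H hH)
    have hD : ∀ φ, φ ∈ logFields T m ↔ φ ∈ logFields T m' ∧
        linForm K V (form H) ^ (k + 1) ∣ FormField.eval (form H) φ := by
      intro φ
      rw [mem_logFields_iff_form hT, mem_logFields_iff_form hT]
      constructor
      · intro h
        have hφ := h H hH
        rw [hk] at hφ
        refine ⟨fun H' hH' => ?_, hφ⟩
        rcases eq_or_ne H' H with rfl | hne
        · rw [hm'H]
          exact (pow_dvd_pow _ k.le_succ).trans hφ
        · rw [hm' _ hne]
          exact h H' hH'
      · rintro ⟨h, hφ⟩ H' hH'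
        rcases eq_or_ne H' H with rfl | hne
        · rw [hk]
          exact hφ
        · rw [← hm' _ hne]
          exact h H' hH'
    have hdvd : ∀ φ ∈ logFields T m', linForm K V (form H) ^ k ∣ FormField.eval (form H) φ := by
      intro φ hφ
      have := hφ H hH _ (ker_form (hT H hH))
      rwa [hm'H] at this
    -- When `θ₁` already satisfies the stronger condition at `H`, replacing `θ₂` by `α_H θ₂` is
    -- enough. Then `θ₂` fails the condition, since otherwise all fields for `m'` would satisfy it.
    have key : ∀ {d₁ d₂ : ℕ} {θ₁ θ₂ : FormField K V}, d₁ + d₂ = N → θ₁ ∈ homogeneous K V d₁ →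
        θ₂ ∈ homogeneous K V d₂ → IsPairBasis (logFields T m') θ₁ θ₂ →
        linForm K V (form H) ^ (k + 1) ∣ FormField.eval (form H) θ₁ →
        ∃ d₁ d₂ : ℕ, d₁ + d₂ = N + 1 ∧ ∃ θ₁ ∈ homogeneous K V d₁, ∃ θ₂ ∈ homogeneous K V d₂,
          IsPairBasis (logFields T m) θ₁ θ₂ := by
      intro d₁ d₂ θ₁ θ₂ hd h₁ h₂ hb h
      refine ⟨d₁, 1 + d₂, by omega, θ₁, h₁, linForm K V (form H) • θ₂,
        smul_mem_homogeneous (linForm_mem _) h₂,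
        hb.smul_of_prime_pow hp _ hD h (hdvd _ hb.right_mem) fun h' => ?_⟩
      obtain ⟨φ, hφ, hφ'⟩ := exists_mem_logFields_not_dvd hT m' hH
      obtain ⟨f, g, rfl⟩ := (hb.mem_iff φ).mp hφ
      rw [hm'H] at hφ'
      exact hφ' (dvd_add (h.mul_left f) (h'.mul_left g))
    -- If `θ₂` satisfies the condition, exchange the roles. Otherwise `d₂ ≤ d₁` leaves room for a
    -- homogeneous multiple of `θ₂` that corrects `θ₁`.
    have key' : ∀ {d₁ d₂ : ℕ} {θ₁ θ₂ : FormField K V}, d₁ + d₂ = N → d₂ ≤ d₁ →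
        θ₁ ∈ homogeneous K V d₁ → θ₂ ∈ homogeneous K V d₂ →
        IsPairBasis (logFields T m') θ₁ θ₂ →
        ∃ d₁ d₂ : ℕ, d₁ + d₂ = N + 1 ∧ ∃ θ₁ ∈ homogeneous K V d₁, ∃ θ₂ ∈ homogeneous K V d₂,
          IsPairBasis (logFields T m) θ₁ θ₂ := by
      intro d₁ d₂ θ₁ θ₂ hd hle h₁ h₂ hb
      by_cases hθ : linForm K V (form H) ^ (k + 1) ∣ FormField.eval (form H) θ₂
      · exact key (by omega) h₂ h₁ hb.symm hθ
      · obtain ⟨s, hs, hs'⟩ := exists_pow_succ_dvd_sub hV (hT H hH) hle (h₁ _) (h₂ _)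
          (hdvd _ hb.left_mem) (hdvd _ hb.right_mem) hθ
        refine key hd (sub_mem h₁ ?_) h₂ (hb.sub_smul s) hs'
        simpa [Nat.sub_add_cancel hle] using smul_mem_homogeneous hs h₂
    obtain ⟨d₁, d₂, hd, θ₁, h₁, θ₂, h₂, hb⟩ := ih m' hsum
    rcases le_total d₂ d₁ with hle | hle
    · exact key' hd hle h₁ h₂ hb
    · exact key' (by omega) hle h₂ h₁ hb.symm

/-! ### Hilbert functions of planar multiarrangements -/

/-- The homogeneous coefficients `f` such that `f • θ` has degree `d`, for `θ` of degree `e`. -/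
def coefficientPart (K V : Type*) [Field K] [AddCommGroup V] [Module K V] (d e : ℕ) :
    Submodule K (PolyFun K V) :=
  if e ≤ d then homogeneousPart K V (d - e) else ⊥

theorem coefficientPart_of_le {d e : ℕ} (h : e ≤ d) :
    coefficientPart K V d e = homogeneousPart K V (d - e) := if_pos h

theorem coefficientPart_of_not_le {d e : ℕ} (h : ¬ e ≤ d) : coefficientPart K V d e = ⊥ := if_neg h

instance [FiniteDimensional K V] (d e : ℕ) : FiniteDimensional K (coefficientPart K V d e) := by
  by_cases h : e ≤ d
  · rw [coefficientPart_of_le h]; infer_instance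
  · rw [coefficientPart_of_not_le h]; infer_instance

theorem finrank_coefficientPart (hV : finrank K V = 2) (d e : ℕ) :
    finrank K (coefficientPart K V d e) = d + 1 - e := by
  by_cases h : e ≤ d
  · rw [coefficientPart_of_le h, finrank_homogeneousPart_of_finrank_two hV]; omega
  · rw [coefficientPart_of_not_le h, finrank_bot]; omega

theorem smul_mem_of_mem_coefficientPart {d e : ℕ} {f : PolyFun K V} {θ : FormField K V}
    (hf : f ∈ coefficientPart K V d e) (hθ : θ ∈ homogeneous K V e) :
    f • θ ∈ homogeneous K V d := by
  unfold coefficientPart at hf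
  split_ifs at hf with h
  · simpa [Nat.sub_add_cancel h] using smul_mem_homogeneous hf hθ
  · rw [(Submodule.mem_bot K).mp hf, zero_smul]
    exact zero_mem _

theorem exists_component_smul {e : ℕ} {θ : FormField K V} (hθ : θ ∈ homogeneous K V e) (d : ℕ)
    (f : PolyFun K V) : ∃ g ∈ coefficientPart K V d e, component d (f • θ) = g • θ := by
  unfold coefficientPart
  split_ifs with h
  · refine ⟨comp (d - e) f, comp_mem _ _, LinearMap.ext fun α => ?_⟩
    have := comp_mul_add (hθ α) (d - e) f
    rw [Nat.add_sub_cancel' h] at this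
    rw [component_apply, LinearMap.smul_apply, LinearMap.smul_apply, smul_eq_mul, smul_eq_mul,
      mul_comm, this, mul_comm]
  · refine ⟨0, zero_mem _, LinearMap.ext fun α => ?_⟩
    rw [component_apply, LinearMap.smul_apply, smul_eq_mul, mul_comm,
      comp_mul_of_lt (not_le.mp h) (hθ α), zero_smul, LinearMap.zero_apply]

theorem component_of_mem {d : ℕ} {φ : FormField K V} (h : φ ∈ homogeneous K V d) :
    component d φ = φ := LinearMap.ext fun α => comp_of_mem (h α)

/-- In degree `d` the module is S_{d-d₁} ⊕ S_{d-d₂}; the truncated subtraction gives 0 when an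
exponent exceeds `d`. -/
theorem finrank_logPart_of_isPairBasis (hV : finrank K V = 2) {T : Finset (Submodule K V)}
    {m : Submodule K V → ℕ} {d₁ d₂ : ℕ} {θ₁ θ₂ : FormField K V}
    (h₁ : θ₁ ∈ homogeneous K V d₁) (h₂ : θ₂ ∈ homogeneous K V d₂)
    (hb : IsPairBasis (logFields T m) θ₁ θ₂) (d : ℕ) :
    finrank K (logPart T m d) = (d + 1 - d₁) + (d + 1 - d₂) := by
  have := FiniteDimensional.of_finrank_pos (K := K) (V := V) (by omega)
  let F : (coefficientPart K V d d₁ × coefficientPart K V d d₂) →ₗ[K] logPart T m d :=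
    { toFun := fun c => ⟨c.1.1 • θ₁ + c.2.1 • θ₂, (hb.mem_iff _).mpr ⟨_, _, rfl⟩,
        add_mem (smul_mem_of_mem_coefficientPart c.1.2 h₁)
          (smul_mem_of_mem_coefficientPart c.2.2 h₂)⟩
      map_add' := fun a b => Subtype.ext <| by
        simp only [Prod.fst_add, Prod.snd_add, Submodule.coe_add, add_smul]
        abel
      map_smul' := fun r a => Subtype.ext <| by
        simp [smul_add] }
  have hF : Function.Bijective F := by
    constructor
    · rw [injective_iff_map_eq_zero]
      rintro ⟨a, b⟩ h
      obtain ⟨ha, hb⟩ := hb.indep _ _ (congrArg Subtype.val h)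
      exact Prod.ext (Subtype.ext ha) (Subtype.ext hb)
    · rintro ⟨φ, hφ, hφ'⟩
      obtain ⟨f, g, hfg⟩ := (hb.mem_iff φ).mp hφ
      obtain ⟨f', hf', hf⟩ := exists_component_smul h₁ d f
      obtain ⟨g', hg', hg⟩ := exists_component_smul h₂ d g
      refine ⟨(⟨f', hf'⟩, ⟨g', hg'⟩), Subtype.ext ?_⟩
      change f' • θ₁ + g' • θ₂ = φ
      rw [← hf, ← hg, ← component_of_mem hφ', hfg]
      exact (LinearMap.comp_add _ _ _).symm
  rw [← (LinearEquiv.ofBijective F hF).finrank_eq, finrank_prod, finrank_coefficientPart hV,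
    finrank_coefficientPart hV]

/-- The sum of the exponents can be read off from the Hilbert function in a large degree, so it
agrees with that of the basis already constructed. -/
theorem add_eq_of_isPairBasis (hV : finrank K V = 2) {T : Finset (Submodule K V)}
    (hT : ∀ H ∈ T, finrank K (V ⧸ H) = 1) {m : Submodule K V → ℕ} {d₁ d₂ : ℕ}
    {θ₁ θ₂ : FormField K V} (h₁ : θ₁ ∈ homogeneous K V d₁) (h₂ : θ₂ ∈ homogeneous K V d₂)
    (hb : IsPairBasis (logFields T m) θ₁ θ₂) : d₁ + d₂ = ∑ H ∈ T, m H := by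
  obtain ⟨e₁, e₂, he, η₁, g₁, η₂, g₂, hb'⟩ := exists_homogeneous_isPairBasis hV hT m
  -- This degree is at least every exponent involved, so no subtraction is truncated.
  have h := finrank_logPart_of_isPairBasis hV h₁ h₂ hb (d₁ + d₂ + e₁ + e₂)
  rw [finrank_logPart_of_isPairBasis hV g₁ g₂ hb'] at h
  omega

end

noncomputable section

open PolyFun FormField

variable {K V : Type*} [Field K] [AddCommGroup V] [Module K V]

/-! ### Restricting hyperplanes to a hyperplane -/

theorem exists_eq_smul_add_smul {H : Submodule K V} {α β γ : Dual K V} (hα : LinearMap.ker α = H)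
    (h : LinearMap.ker (H.subtype.dualMap γ) ≤ LinearMap.ker (H.subtype.dualMap β)) :
    ∃ a b : K, β = a • γ + b • α := by
  obtain ⟨a, ha⟩ := exists_smul_of_ker_le h
  have : LinearMap.ker α ≤ LinearMap.ker (β - a • γ) := by
    rw [hα, ← restrict_eq_zero_iff, map_sub, map_smul, ha, sub_self]
  obtain ⟨b, hb⟩ := exists_smul_of_ker_le this
  exact ⟨a, b, by rw [← hb]; abel⟩

theorem ker_restrict_form {H H' : Submodule K V} (h' : finrank K (V ⧸ H') = 1) :
    LinearMap.ker (H.subtype.dualMap (form H')) = H'.comap H.subtype := by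
  conv_rhs => rw [← ker_form h']
  rfl

/-- Fields that vanish on a linear form `α`, and are tangent to several hyperplanes whose equations
are combinations of `α` and `γ`. -/
theorem prod_dvd_apply {T : Finset (Submodule K V)} (hT : ∀ H ∈ T, finrank K (V ⧸ H) = 1)
    {α γ : Dual K V} {φ : FormField K V} (hα : φ α = 0) (hφ : φ ∈ logFields T fun _ => 1)
    (h : ∀ H ∈ T, ∃ a b : K, a ≠ 0 ∧ form H = a • γ + b • α) :
    ∏ H ∈ T, linForm K V (form H) ∣ φ γ := by
  have := prod_pow_dvd_of_prime T (p := fun H => linForm K V (form H)) (k := fun _ => 1) (f := φ γ)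
    (fun H hH => prime_form (hT H hH)) (fun H hH H' hH' => form_not_dvd (hT H hH) (hT H' hH'))
    fun H hH => by
      obtain ⟨a, b, ha, hab⟩ := h H hH
      have h1 := hφ H hH _ (ker_form (hT H hH))
      have h2 : φ (form H) = algebraMap K _ a * φ γ := by
        rw [hab, map_add, map_smul, map_smul, hα, smul_zero, add_zero, Algebra.smul_def]
      rw [h2] at h1
      exact ((IsUnit.mk0 a ha).map (algebraMap K (PolyFun K V))).dvd_mul_left.mp h1
  simpa using this

theorem associated_linForm {α β : Dual K V} (h : LinearMap.ker α = LinearMap.ker β) :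
    Associated (linForm K V α) (linForm K V β) :=
  associated_of_dvd_dvd (linForm_dvd_iff.mpr h.le) (linForm_dvd_iff.mpr h.ge)

theorem associated_res_form {H H' : Submodule K V} (hH : finrank K (V ⧸ H) = 1)
    (hH' : finrank K (V ⧸ H') = 1) (hne : H' ≠ H) :
    Associated (res H (linForm K V (form H')))
      (linForm K H (form (H'.comap H.subtype))) := by
  rw [res_linForm]
  exact associated_linForm ((ker_restrict_form hH').trans
    (ker_form (Arrangement.finrank_quotient_comap hH hH' hne)).symm)

theorem associated_prod_res_form {H : Submodule K V} {T : Finset (Submodule K V)}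
    {X : Submodule K H} (hH : finrank K (V ⧸ H) = 1) (hT : ∀ H' ∈ T, finrank K (V ⧸ H') = 1)
    (hne : H ∉ T) (hX : ∀ H' ∈ T, H'.comap H.subtype = X) :
    Associated (res H (∏ H' ∈ T, linForm K V (form H'))) (linForm K H (form X) ^ T.card) := by
  rw [map_prod, ← Finset.prod_const]
  refine Associated.prod _ _ _ fun H' hH' => ?_
  rw [← hX H' hH']
  exact associated_res_form hH (hT H' hH') (fun h => hne (h ▸ hH'))

variable {T : Finset (Submodule K V)} {H : Submodule K V}

open Classical in
/-- The restrictions of the hyperplanes in `T` to `H`. -/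
def restrictions (T : Finset (Submodule K V)) (H : Submodule K V) : Finset (Submodule K H) :=
  T.image fun H' => H'.comap H.subtype

open Classical in
/-- The members of `T` with restriction `X`. -/
def fiber (T : Finset (Submodule K V)) {H : Submodule K V} (X : Submodule K H) :
    Finset (Submodule K V) :=
  T.filter fun H' => H'.comap H.subtype = X

theorem mem_fiber {X : Submodule K H} {H' : Submodule K V} :
    H' ∈ fiber T X ↔ H' ∈ T ∧ H'.comap H.subtype = X := by
  classical
  exact Finset.mem_filter

theorem mem_restrictions {X : Submodule K H} :
    X ∈ restrictions T H ↔ ∃ H' ∈ T, H'.comap H.subtype = X := by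
  classical
  exact Finset.mem_image

theorem finrank_quotient_of_mem_restrictions (hT : ∀ H' ∈ T, finrank K (V ⧸ H') = 1)
    (hH : finrank K (V ⧸ H) = 1) (hHT : H ∉ T) {X : Submodule K H} (hX : X ∈ restrictions T H) :
    finrank K (H ⧸ X) = 1 := by
  obtain ⟨H', hH', rfl⟩ := mem_restrictions.mp hX
  exact Arrangement.finrank_quotient_comap hH (hT H' hH') fun h => hHT (h ▸ hH')

theorem card_fiber_pos {X : Submodule K H} (hX : X ∈ restrictions T H) : 0 < (fiber T X).card := by
  obtain ⟨H', hH', h⟩ := mem_restrictions.mp hX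
  exact Finset.card_pos.mpr ⟨H', mem_fiber.mpr ⟨hH', h⟩⟩

theorem sum_card_fiber : ∑ X ∈ restrictions T H, (fiber T X).card = T.card := by
  classical
  exact (Finset.card_eq_sum_card_image _ _).symm

/-- Restricting a logarithmic field to a member of the arrangement. -/
theorem pow_card_fiber_dvd_res (hT : ∀ H' ∈ T, finrank K (V ⧸ H') = 1)
    (hH : finrank K (V ⧸ H) = 1) (hHT : H ∉ T) {φ : FormField K V}
    (hφ : φ ∈ logFields T fun _ => 1) (hφH : φ (form H) = 0) {γ : Dual K V} {X : Submodule K H}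
    (hX : X ∈ restrictions T H) (hγ : LinearMap.ker (H.subtype.dualMap γ) = X) :
    linForm K H (H.subtype.dualMap γ) ^ (fiber T X).card ∣ res H (φ γ) := by
  have hsub : fiber T X ⊆ T := fun H' h => (mem_fiber.mp h).1
  have hX1 := finrank_quotient_of_mem_restrictions hT hH hHT hX
  -- All members of `T` through `X` have equations `a γ + b α_H` with `a ≠ 0`. As `φ` kills `α_H`,
  -- each of these equations divides `φ γ`; this accounts for the multiplicity of `X`.
  have hdvd := prod_dvd_apply (T := fiber T X) (γ := γ) (fun H' h => hT H' (hsub h)) hφH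
    (fun H' h => hφ H' (hsub h)) fun H' h => by
      have hk : LinearMap.ker (H.subtype.dualMap (form H')) = X :=
        (ker_restrict_form (hT H' (hsub h))).trans (mem_fiber.mp h).2
      obtain ⟨a, b, hab⟩ := exists_eq_smul_add_smul (β := form H') (γ := γ) (ker_form hH)
        (hγ.trans hk.symm).le
      refine ⟨a, b, ?_, hab⟩
      rintro rfl
      refine ne_zero_of_ker_eq hX1 hk (restrict_eq_zero_iff.mpr ?_)
      rw [hab, zero_smul, zero_add]
      intro v hv
      rw [← ker_form hH, LinearMap.mem_ker] at hv
      simp [hv]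
  have h1 := map_dvd (res H) hdvd
  rw [(associated_prod_res_form hH (fun H' h => hT H' (hsub h)) (fun h => hHT (hsub h))
    fun H' h => (mem_fiber.mp h).2).dvd_iff_dvd_left] at h1
  rwa [(Associated.pow_pow (associated_linForm (hγ.trans (ker_form hX1).symm))).dvd_iff_dvd_left]

/-! ### Adding a hyperplane -/

/-- The polynomial on `H` that divides `φ(α_H)` for all logarithmic fields of an arrangement not
containing `H`. -/
def obstruction (T : Finset (Submodule K V)) (H : Submodule K V) : PolyFun K H :=
  ∏ X ∈ restrictions T H, linForm K H (form X) ^ ((fiber T X).card - 1)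

theorem obstruction_mem :
    obstruction T H ∈ homogeneousPart K H (T.card - (restrictions T H).card) := by
  have : T.card - (restrictions T H).card =
      ∑ X ∈ restrictions T H, ((fiber T X).card - 1) := by
    have h := Finset.sum_tsub_distrib (restrictions T H) (f := fun X => (fiber T X).card)
      (g := fun _ => 1) fun X hX => card_fiber_pos hX
    rw [h, sum_card_fiber, ← Finset.card_eq_sum_ones]
  rw [this]
  exact prod_mem _ fun X _ => linForm_pow_mem _ _

theorem card_restrictions_le : (restrictions T H).card ≤ T.card := by
  classical
  exact Finset.card_image_le

theorem obstruction_ne_zero (hT : ∀ H' ∈ T, finrank K (V ⧸ H') = 1)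
    (hH : finrank K (V ⧸ H) = 1) (hHT : H ∉ T) : obstruction T H ≠ 0 :=
  Finset.prod_ne_zero_iff.mpr fun _ hX => pow_ne_zero _
    (prime_form (finrank_quotient_of_mem_restrictions hT hH hHT hX)).ne_zero

/-- Fix `H₁` over `X` and subtract a multiple of the Euler field so that `φ` kills the equation of
`H₁`. The other members over `X` lie in the pencil of `α_{H₁}` and `α_H`, so their product divides
the new value at `α_H`. On `H` the correction vanishes, which leaves one factor fewer than the size
of the fiber. -/
theorem obstruction_dvd (hT : ∀ H' ∈ T, finrank K (V ⧸ H') = 1)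
    (hH : finrank K (V ⧸ H) = 1) (hHT : H ∉ T) {φ : FormField K V}
    (hφ : φ ∈ logFields T fun _ => 1) : obstruction T H ∣ res H (φ (form H)) := by
  classical
  have hR := fun X hX => finrank_quotient_of_mem_restrictions hT hH hHT (X := X) hX
  refine prod_pow_dvd_of_prime _ (fun X hX => prime_form (hR X hX))
    (fun X hX Y hY => form_not_dvd (hR X hX) (hR Y hY)) fun X hX => ?_
  obtain ⟨H₁, hH₁, hX₁⟩ := mem_restrictions.mp hX
  obtain ⟨g, hg⟩ := hφ H₁ hH₁ _ (ker_form (hT H₁ hH₁))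
  rw [pow_one] at hg
  have hsub : (fiber T X).erase H₁ ⊆ T := fun H' h =>
    (mem_fiber.mp (Finset.mem_of_mem_erase h)).1
  have hres : ∀ H' ∈ (fiber T X).erase H₁, H'.comap H.subtype = X := fun H' h =>
    (mem_fiber.mp (Finset.mem_of_mem_erase h)).2
  have hψ : φ - g • linForm K V ∈ logFields T fun _ => 1 :=
    sub_mem hφ (Submodule.smul_mem _ g (linForm_mem_logFields T))
  have hdvd := prod_dvd_apply (T := (fiber T X).erase H₁) (α := form H₁) (γ := form H)
    (fun H' h => hT H' (hsub h)) (φ := φ - g • linForm K V)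
    (by rw [LinearMap.sub_apply, LinearMap.smul_apply, hg, smul_eq_mul, mul_comm, sub_self])
    (fun H' h => hψ H' (hsub h)) fun H' h => by
      have hH' := hT H' (hsub h)
      obtain ⟨a, b, hab⟩ := exists_eq_smul_add_smul (β := form H') (γ := form H₁) (ker_form hH)
        ((ker_restrict_form (hT H₁ hH₁)).trans (hX₁.trans
          ((ker_restrict_form hH').trans (hres H' h)).symm)).le
      refine ⟨b, a, ?_, by rw [hab, add_comm]⟩
      rintro rfl
      refine form_not_dvd (hT H₁ hH₁) hH' (Finset.ne_of_mem_erase h).symm ?_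
      rw [hab, zero_smul, add_zero, map_smul, Algebra.smul_def]
      exact dvd_mul_left _ _
  have h1 := map_dvd (res H) hdvd
  rw [(associated_prod_res_form hH (fun H' h => hT H' (hsub h)) (fun h => hHT (hsub h))
    hres).dvd_iff_dvd_left, LinearMap.sub_apply, LinearMap.smul_apply, map_sub, smul_eq_mul,
    map_mul, (res_eq_zero_iff (ker_form hH)).mpr dvd_rfl, mul_zero, sub_zero,
    Finset.card_erase_of_mem (mem_fiber.mpr ⟨hH₁, hX₁⟩)] at h1
  exact h1

/-- The values on `H` of the logarithmic fields at the equation of `H`. -/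
def valueIdeal (T : Finset (Submodule K V)) (H : Submodule K V) : Ideal (PolyFun K H) where
  carrier := {f | ∃ φ ∈ logFields T fun _ => 1, res H (φ (form H)) = f}
  zero_mem' := ⟨0, zero_mem _, by simp⟩
  add_mem' := by
    rintro _ _ ⟨φ, hφ, rfl⟩ ⟨ψ, hψ, rfl⟩
    exact ⟨φ + ψ, add_mem hφ hψ, by simp⟩
  smul_mem' := by
    rintro c _ ⟨φ, hφ, rfl⟩
    exact ⟨extend H c • φ, Submodule.smul_mem _ _ hφ, by simp⟩

-- For `H₁` over `X`, take the constant field along some `v ∈ H₁` with `α_H(v) = 1`, times the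
-- equations of all other members of `T`. It is tangent to `H₁` because `v ∈ H₁`, and its value at
-- `α_H`, restricted to `H`, is the stated product up to a unit.
open Classical in
theorem obstruction_mul_prod_mem (hT : ∀ H' ∈ T, finrank K (V ⧸ H') = 1)
    (hH : finrank K (V ⧸ H) = 1) (hHT : H ∉ T) {X : Submodule K H} (hX : X ∈ restrictions T H) :
    obstruction T H * ∏ Y ∈ (restrictions T H).erase X, linForm K H (form Y) ∈
      valueIdeal T H := by
  obtain ⟨H₁, hH₁, hX₁⟩ := mem_restrictions.mp hX
  obtain ⟨v, hv, hv'⟩ : ∃ v ∈ H₁, form H v = 1 := by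
    obtain ⟨w, hw, hw'⟩ : ∃ w ∈ H₁, w ∉ H := by
      by_contra! h
      exact hHT (eq_of_hyperplane_le (hT H₁ hH₁) hH h ▸ hH₁)
    have hw0 : form H w ≠ 0 := fun h => hw' (by rw [← ker_form hH]; exact h)
    exact ⟨(form H w)⁻¹ • w, H₁.smul_mem _ hw, by simp [hw0]⟩
  have hmem : (∏ H' ∈ T.erase H₁, linForm K V (form H')) • const K v ∈ logFields T fun _ => 1 := by
    rw [mem_logFields_iff_form hT]
    intro H' hH'
    rcases eq_or_ne H' H₁ with rfl | hne
    · rw [← ker_form (hT H' hH')] at hv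
      rw [LinearMap.smul_apply, const_apply, LinearMap.mem_ker.mp hv, map_zero, smul_zero]
      exact dvd_zero _
    · rw [pow_one]
      exact (Finset.dvd_prod_of_mem (fun H' => linForm K V (form H'))
        (Finset.mem_erase.mpr ⟨hne, hH'⟩)).mul_right _
  have hval : res H (∏ H' ∈ T.erase H₁, linForm K V (form H')) ∈ valueIdeal T H :=
    ⟨_, hmem, by rw [LinearMap.smul_apply, const_apply, hv', map_one, smul_eq_mul, mul_one]⟩
  have hassoc : Associated (res H (∏ H' ∈ T.erase H₁, linForm K V (form H')))
      (∏ H' ∈ T.erase H₁, linForm K H (form (H'.comap H.subtype))) := by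
    rw [map_prod]
    refine Associated.prod _ _ _ fun H' hH' => associated_res_form hH (hT H' ?_) ?_
    · exact Finset.mem_of_mem_erase hH'
    · rintro rfl
      exact hHT (Finset.mem_of_mem_erase hH')
  have heq : ∏ H' ∈ T.erase H₁, linForm K H (form (H'.comap H.subtype)) =
      obstruction T H * ∏ Y ∈ (restrictions T H).erase X, linForm K H (form Y) := by
    have hp := prime_form (finrank_quotient_of_mem_restrictions hT hH hHT hX)
    -- After multiplication by the equation of `X`, both sides are the product of the restricted
    -- equations over all of `T`, grouped by fibers on the right.
    apply mul_left_cancel₀ hp.ne_zero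
    rw [mul_left_comm, Finset.mul_prod_erase _ (fun Y => linForm K H (form Y)) hX, obstruction,
      ← Finset.prod_mul_distrib]
    conv_lhs =>
      rw [← hX₁, Finset.mul_prod_erase T (fun H' => linForm K H (form (H'.comap H.subtype))) hH₁]
    rw [← Finset.prod_fiberwise_of_maps_to (g := fun H' => H'.comap H.subtype)
      (t := restrictions T H) fun H' h => mem_restrictions.mpr ⟨H', h, rfl⟩]
    refine Finset.prod_congr rfl fun Y hY => ?_
    rw [← pow_succ, Nat.sub_add_cancel (card_fiber_pos hY)]
    exact Finset.prod_eq_pow_card fun H' h => by rw [(Finset.mem_filter.mp h).2]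
  rw [← heq]
  exact Ideal.mem_of_dvd _ hassoc.dvd hval

/-! ### Ideals of products of lines in a plane -/

variable (K V) in
/-- The ideal generated by the linear forms. -/
def irrelevantIdeal : Ideal (PolyFun K V) := Ideal.span (LinearMap.range (linForm K V))

theorem homogeneousPart_le_irrelevantIdeal_pow {d : ℕ} {f : PolyFun K V}
    (hf : f ∈ homogeneousPart K V d) : f ∈ irrelevantIdeal K V ^ d := by
  induction d generalizing f with
  | zero => simp
  | succ d ih =>
    rw [homogeneousPart, pow_succ] at hf
    rw [pow_succ]
    induction hf using Submodule.mul_induction_on' with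
    | mem_mul_mem m hm n hn => exact Ideal.mul_mem_mul (ih hm) (Ideal.subset_span hn)
    | add x _ y _ hx hy => exact add_mem hx hy

theorem irrelevantIdeal_le (hV : finrank K V = 2) {X Y : Submodule K V}
    (hX : finrank K (V ⧸ X) = 1) (hY : finrank K (V ⧸ Y) = 1) (hne : X ≠ Y) :
    irrelevantIdeal K V ≤ Ideal.span {linForm K V (form X), linForm K V (form Y)} := by
  have := FiniteDimensional.of_finrank_pos (K := K) (V := V) (by omega)
  rw [irrelevantIdeal, Ideal.span_le]
  rintro _ ⟨γ, rfl⟩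
  have hX1 : finrank K (Dual K X) = 1 := by
    have := X.finrank_quotient_add_finrank
    rw [Subspace.dual_finrank_eq]
    omega
  have h0 : X.subtype.dualMap (form Y) ≠ 0 := by
    rw [Ne, restrict_eq_zero_iff, ker_form hY]
    exact fun h => hne (eq_of_hyperplane_le hX hY h)
  obtain ⟨c, hc⟩ := exists_smul_eq_of_finrank_eq_one hX1 h0 (X.subtype.dualMap γ)
  have : LinearMap.ker (form X) ≤ LinearMap.ker (γ - c • form Y) := by
    rw [ker_form hX, ← restrict_eq_zero_iff, map_sub, map_smul, hc, sub_self]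
  obtain ⟨b, hb⟩ := exists_smul_of_ker_le this
  refine Ideal.mem_span_pair.mpr ⟨algebraMap _ _ b, algebraMap _ _ c, ?_⟩
  rw [← Algebra.smul_def, ← Algebra.smul_def, ← map_smul, ← map_smul, ← hb, ← map_add,
    sub_add_cancel]

-- This is Lagrange interpolation. When a line `Z` is added, a linear form is a combination of the
-- equations of `X` and `Z`. Times the product omitting `X`, the first summand becomes the product
-- omitting `Z`, and the second the larger product omitting `X`.
open Classical in
theorem irrelevantIdeal_pow_le (hV : finrank K V = 2) {R : Finset (Submodule K V)}
    (hR : ∀ X ∈ R, finrank K (V ⧸ X) = 1) (hne : R.Nonempty) :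
    irrelevantIdeal K V ^ (R.card - 1) ≤
      Ideal.span ((fun X => ∏ Y ∈ R.erase X, linForm K V (form Y)) '' R) := by
  induction hne using Finset.Nonempty.cons_induction with
  | singleton X => simp
  | cons Z R hZ hne ih =>
    rw [Finset.card_cons, Nat.add_sub_cancel, ← Nat.sub_add_cancel hne.card_pos, pow_succ']
    refine (Ideal.mul_mono_right (ih fun X hX => hR X (by simp [hX]))).trans ?_
    rw [Ideal.mul_le]
    intro r hr s hs
    induction hs using Submodule.span_induction with
    | zero => simp
    | add x y _ _ hx hy => rw [mul_add]; exact add_mem hx hy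
    | smul a x _ hx => rw [smul_eq_mul, mul_left_comm]; exact Ideal.mul_mem_left _ _ hx
    | mem x hx =>
      obtain ⟨X, hX, rfl⟩ := hx
      have hX' : X ∈ R := hX
      have hXZ : X ≠ Z := fun h => hZ (h ▸ hX')
      obtain ⟨a, b, rfl⟩ := Ideal.mem_span_pair.mp
        (irrelevantIdeal_le hV (hR X (by simp [hX'])) (hR Z (by simp)) hXZ hr)
      rw [Finset.cons_eq_insert, add_mul]
      refine add_mem ?_ ?_
      · rw [mul_assoc, Finset.mul_prod_erase _ (fun Y => linForm K V (form Y)) hX']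
        refine Ideal.mul_mem_left _ _ (Ideal.subset_span ⟨Z, by simp, ?_⟩)
        simp only [Finset.erase_insert hZ]
      · rw [mul_assoc]
        refine Ideal.mul_mem_left _ _ (Ideal.subset_span ⟨X, by simp [hX'], ?_⟩)
        simp only
        rw [Finset.erase_insert_of_ne hXZ.symm, Finset.prod_insert (by simp [hZ])]

theorem obstruction_mul_mem (hV : finrank K V = 3) (hT : ∀ H' ∈ T, finrank K (V ⧸ H') = 1)
    (hH : finrank K (V ⧸ H) = 1) (hHT : H ∉ T) {e : ℕ} (he : (restrictions T H).card - 1 ≤ e)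
    {f : PolyFun K H} (hf : f ∈ homogeneousPart K H e) :
    obstruction T H * f ∈ valueIdeal T H := by
  classical
  have := FiniteDimensional.of_finrank_pos (K := K) (V := V) (by omega)
  -- Without restrictions the bound is the truncated `0 - 1 = 0`; then a constant field already
  -- shows that the ideal of values is everything.
  rcases (restrictions T H).eq_empty_or_nonempty with hR | hR
  · have hT0 : T = ∅ := Finset.image_eq_empty.mp hR
    obtain ⟨v, hv⟩ := LinearMap.surjective (form_ne_zero hH) 1
    have h1 : (1 : PolyFun K H) ∈ valueIdeal T H :=
      ⟨const K v, fun H' hH' => by simp [hT0] at hH', by rw [const_apply, hv, map_one, map_one]⟩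
    rw [(Ideal.eq_top_iff_one _).mpr h1]
    exact trivial
  · have hH2 : finrank K H = 2 := by
      have := H.finrank_quotient_add_finrank
      omega
    have hR1 := fun X hX => finrank_quotient_of_mem_restrictions hT hH hHT (X := X) hX
    have h := irrelevantIdeal_pow_le hH2 hR1 hR
      (Ideal.pow_le_pow_right he (homogeneousPart_le_irrelevantIdeal_pow hf))
    clear hf
    induction h using Submodule.span_induction with
    | zero => simp
    | add x y _ _ hx hy => rw [mul_add]; exact add_mem hx hy
    | smul a x _ hx => rw [smul_eq_mul, mul_left_comm]; exact Ideal.mul_mem_left _ _ hx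
    | mem x hx =>
      obtain ⟨X, hX, rfl⟩ := hx
      exact obstruction_mul_prod_mem hT hH hHT hX

open Classical in
theorem mem_logFields_insert (hH : finrank K (V ⧸ H) = 1) {φ : FormField K V} :
    φ ∈ logFields (insert H T) (fun _ => 1) ↔
      φ ∈ logFields T (fun _ => 1) ∧ res H (φ (form H)) = 0 := by
  rw [res_eq_zero_iff (ker_form hH)]
  constructor
  · intro h
    exact ⟨fun H' hH' => h H' (Finset.mem_insert_of_mem hH'),
      by simpa using h H (Finset.mem_insert_self _ _) _ (ker_form hH)⟩
  · rintro ⟨h, h'⟩ H' hH' α hα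
    rcases Finset.mem_insert.mp hH' with rfl | hH'
    · exact pow_dvd_apply_of_ker_eq (k := 1) ((ker_form hH).trans hα.symm) (by simpa using h')
    · exact h H' hH' α hα

open Classical in
/-- The Hilbert function of an arrangement changes in a predictable way when a hyperplane is
added. -/
theorem finrank_logPart_insert (hV : finrank K V = 3) (hT : ∀ H' ∈ T, finrank K (V ⧸ H') = 1)
    (hH : finrank K (V ⧸ H) = 1) (hHT : H ∉ T) {d : ℕ} (hd : T.card ≤ d) :
    finrank K (logPart (insert H T) (fun _ => 1) d) +
      (d + 1 - (T.card - (restrictions T H).card)) = finrank K (logPart T (fun _ => 1) d) := by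
  have := FiniteDimensional.of_finrank_pos (K := K) (V := V) (by omega)
  have hH2 : finrank K H = 2 := by
    have := H.finrank_quotient_add_finrank
    omega
  have hle := card_restrictions_le (T := T) (H := H)
  set c := T.card - (restrictions T H).card with hc
  have hcd : c + (d - c) = d := by omega
  -- The kernel of `ρ` consists of the fields that are also tangent to `H`; its image is the
  -- obstruction times all of K[H]_{d-c}.
  let ρ : logPart T (fun _ => 1) d →ₗ[K] PolyFun K H :=
    (res H).toLinearMap ∘ₗ LinearMap.applyₗ (form H) ∘ₗ (logPart T (fun _ => 1) d).subtype
  have hρ : ∀ φ, ρ φ = res H (φ.1 (form H)) := fun _ => rfl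
  have hker : (LinearMap.ker ρ).map (logPart T (fun _ => 1) d).subtype =
      logPart (insert H T) (fun _ => 1) d := by
    ext φ
    simp only [Submodule.mem_map, LinearMap.mem_ker, hρ, Submodule.subtype_apply,
      Subtype.exists, exists_and_left, exists_prop, mem_logPart, mem_logFields_insert hH]
    constructor
    · rintro ⟨_, h, ⟨h1, h2⟩, rfl⟩
      exact ⟨⟨h1, h⟩, h2⟩
    · rintro ⟨⟨h1, h⟩, h2⟩
      exact ⟨φ, h, ⟨h1, h2⟩, rfl⟩
  have hrange : LinearMap.range ρ =
      (homogeneousPart K H (d - c)).map (LinearMap.mulLeft K (obstruction T H)) := by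
    ext f
    constructor
    · rintro ⟨⟨φ, hφ, hφ'⟩, rfl⟩
      obtain ⟨q, hq⟩ := obstruction_dvd hT hH hHT hφ
      refine ⟨q, mem_of_mul_mem obstruction_mem (obstruction_ne_zero hT hH hHT) ?_, hq.symm⟩
      rw [← hq, ← hc, hcd]
      exact res_mem H (hφ' _)
    · rintro ⟨q, hq, rfl⟩
      -- The assumption `T.card ≤ d` makes `d - c` large enough for every multiple to occur; passing
      -- to the component of degree `d` makes the preimage homogeneous.
      obtain ⟨φ, hφ, h⟩ := obstruction_mul_mem hV hT hH hHT (by omega) hq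
      refine ⟨⟨component d φ, component_mem_logFields hφ d, component_mem d φ⟩, ?_⟩
      rw [hρ, component_apply, ← comp_res, h]
      refine comp_of_mem ?_
      have := mul_mem (obstruction_mem (T := T) (H := H)) hq
      rwa [← hc, hcd] at this
  have h := LinearMap.finrank_range_add_finrank_ker (K := K) (V := logPart T (fun _ => 1) d)
    (V₂ := PolyFun K H) ρ
  have hinj : Function.Injective (LinearMap.mulLeft K (obstruction T H)) :=
    mul_right_injective₀ (obstruction_ne_zero hT hH hHT)
  rw [← hker, ← h, hrange, Submodule.finrank_map_subtype_eq,
    ← (Submodule.equivMapOfInjective _ hinj _).finrank_eq,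
    finrank_homogeneousPart_of_finrank_two hH2]
  omega

end

noncomputable section

open PolyFun FormField

variable {K V : Type*} [Field K] [AddCommGroup V] [Module K V]

/-! ### The Hilbert polynomial of a central arrangement in a three-dimensional space -/

open Classical in
/-- The members of `T` containing `X`. -/
def above (T : Finset (Submodule K V)) (X : Submodule K V) : Finset (Submodule K V) :=
  T.filter fun H => X ≤ H

theorem mem_above {T : Finset (Submodule K V)} {X H : Submodule K V} :
    H ∈ above T X ↔ H ∈ T ∧ X ≤ H := by
  classical
  exact Finset.mem_filter

open Classical in
/-- The intersections of two different members of `T`. -/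
def pairFlats (T : Finset (Submodule K V)) : Finset (Submodule K V) :=
  T.offDiag.image fun p => p.1 ⊓ p.2

theorem mem_pairFlats {T : Finset (Submodule K V)} {X : Submodule K V} :
    X ∈ pairFlats T ↔ ∃ H ∈ T, ∃ H' ∈ T, H ≠ H' ∧ H ⊓ H' = X := by
  classical
  simp only [pairFlats, Finset.mem_image, Finset.mem_offDiag, Prod.exists]
  constructor
  · rintro ⟨a, b, ⟨ha, hb, hne⟩, h⟩
    exact ⟨a, ha, b, hb, hne, h⟩
  · rintro ⟨a, ha, b, hb, hne, h⟩
    exact ⟨a, b, ⟨ha, hb, hne⟩, h⟩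

/-- The sum of the Möbius values of the flats of dimension one. -/
def secondCoeff (T : Finset (Submodule K V)) : ℕ :=
  ∑ X ∈ pairFlats T, ((above T X).card - 1)

theorem finrank_add_one_of_finrank_quotient [FiniteDimensional K V] {H : Submodule K V}
    (hH : finrank K (V ⧸ H) = 1) : finrank K H + 1 = finrank K V := by
  have := H.finrank_quotient_add_finrank
  omega

theorem finrank_inf_of_ne [FiniteDimensional K V] {H H' : Submodule K V}
    (hH : finrank K (V ⧸ H) = 1) (hH' : finrank K (V ⧸ H') = 1) (hne : H ≠ H') :
    finrank K ↥(H ⊓ H') + 2 = finrank K V := by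
  have h1 := finrank_add_one_of_finrank_quotient hH
  have h2 := finrank_add_one_of_finrank_quotient
    (Arrangement.finrank_quotient_comap hH hH' hne.symm)
  rw [← Submodule.map_comap_subtype, Submodule.finrank_map_subtype_eq]
  omega

variable {T : Finset (Submodule K V)} {H : Submodule K V}

theorem finrank_of_mem_pairFlats (hV : finrank K V = 3)
    (hT : ∀ H ∈ T, finrank K (V ⧸ H) = 1) {X : Submodule K V} (hX : X ∈ pairFlats T) :
    finrank K X = 1 := by
  have := FiniteDimensional.of_finrank_pos (K := K) (V := V) (by omega)
  obtain ⟨H, hH, H', hH', hne, rfl⟩ := mem_pairFlats.mp hX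
  have := finrank_inf_of_ne (hT H hH) (hT H' hH') hne
  omega

theorem mem_pairFlats_of_one_lt (hV : finrank K V = 3) (hT : ∀ H ∈ T, finrank K (V ⧸ H) = 1)
    {X : Submodule K V} (hX : finrank K X = 1) (h : 1 < (above T X).card) : X ∈ pairFlats T := by
  have := FiniteDimensional.of_finrank_pos (K := K) (V := V) (by omega)
  obtain ⟨H, hH, H', hH', hne⟩ := Finset.one_lt_card.mp h
  rw [mem_above] at hH hH'
  refine mem_pairFlats.mpr ⟨H, hH.1, H', hH'.1, hne, ?_⟩
  have := finrank_inf_of_ne (hT H hH.1) (hT H' hH'.1) hne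
  exact (Submodule.eq_of_le_of_finrank_eq (le_inf hH.2 hH'.2) (by omega)).symm

-- The term of a one-dimensional flat grows by one exactly when the flat lies in `H` and in some
-- member of `T`; these flats are the lines that `T` cuts out on `H`.
open Classical in
theorem secondCoeff_insert (hV : finrank K V = 3) (hT : ∀ H ∈ T, finrank K (V ⧸ H) = 1)
    (hH : finrank K (V ⧸ H) = 1) (hHT : H ∉ T) :
    secondCoeff (insert H T) = secondCoeff T + (restrictions T H).card := by
  have hT' : ∀ H' ∈ insert H T, finrank K (V ⧸ H') = 1 := by
    intro H' hH'
    rcases Finset.mem_insert.mp hH' with rfl | h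
    exacts [hH, hT H' h]
  have hsub : pairFlats T ⊆ pairFlats (insert H T) := by
    intro X hX
    obtain ⟨H₁, h₁, H₂, h₂, h⟩ := mem_pairFlats.mp hX
    exact mem_pairFlats.mpr
      ⟨H₁, Finset.mem_insert_of_mem h₁, H₂, Finset.mem_insert_of_mem h₂, h⟩
  -- A flat that is new after adding `H` lies in at most one member of `T`, so its truncated term
  -- `card - 1` is 0.
  have h1 : secondCoeff T = ∑ X ∈ pairFlats (insert H T), ((above T X).card - 1) := by
    refine Finset.sum_subset hsub fun X hX hX' => ?_
    have := mt (mem_pairFlats_of_one_lt hV hT (finrank_of_mem_pairFlats hV hT' hX)) hX'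
    omega
  have h2 : ∀ X, (above (insert H T) X).card - 1 = ((above T X).card - 1) +
      if X ≤ H ∧ (above T X).Nonempty then 1 else 0 := by
    intro X
    by_cases hX : X ≤ H
    · have : above (insert H T) X = insert H (above T X) := by
        rw [above, Finset.filter_insert, if_pos hX]; rfl
      rw [this, Finset.card_insert_of_notMem fun h => hHT (mem_above.mp h).1]
      by_cases hn : (above T X).Nonempty
      · have := hn.card_pos
        simp only [hX, hn, and_self, if_true]
        omega
      · rw [if_neg fun h => hn h.2]
        rw [Finset.not_nonempty_iff_eq_empty] at hn
        simp [hn]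
    · have : above (insert H T) X = above T X := by
        rw [above, Finset.filter_insert, if_neg hX]; rfl
      rw [this, if_neg fun h => hX h.1, add_zero]
  have h3 : (pairFlats (insert H T)).filter (fun X => X ≤ H ∧ (above T X).Nonempty) =
      (restrictions T H).image (Submodule.map H.subtype) := by
    ext X
    simp only [Finset.mem_filter, Finset.mem_image, mem_restrictions]
    constructor
    · rintro ⟨hX, hXH, H', hH'⟩
      rw [mem_above] at hH'
      refine ⟨_, ⟨H', hH'.1, rfl⟩, ?_⟩
      have := FiniteDimensional.of_finrank_pos (K := K) (V := V) (by omega)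
      rw [Submodule.map_comap_subtype]
      have h4 := finrank_inf_of_ne hH (hT H' hH'.1) fun h => hHT (h ▸ hH'.1)
      have h5 := finrank_of_mem_pairFlats hV hT' hX
      exact (Submodule.eq_of_le_of_finrank_eq (le_inf hXH hH'.2) (by omega)).symm
    · rintro ⟨_, ⟨H', hH', rfl⟩, rfl⟩
      rw [Submodule.map_comap_subtype]
      exact ⟨mem_pairFlats.mpr ⟨H, Finset.mem_insert_self _ _, H', Finset.mem_insert_of_mem hH',
        fun h => hHT (h ▸ hH'), rfl⟩, inf_le_left, H', mem_above.mpr ⟨hH', inf_le_right⟩⟩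
  rw [secondCoeff, Finset.sum_congr rfl fun X _ => h2 X, Finset.sum_add_distrib, ← h1,
    Finset.sum_boole, h3, Finset.card_image_of_injective _
      (Submodule.map_injective_of_injective H.injective_subtype), Nat.cast_id]

/-- Induction on `T`, starting from the module of all fields. The number of restrictions enters both
the drop in dimension and the growth of `secondCoeff`, which is why only the latter and the
cardinality remain. The factor 2 avoids denominators. -/
theorem finrank_logPart (hV : finrank K V = 3) (hT : ∀ H ∈ T, finrank K (V ⧸ H) = 1) {d : ℕ}
    (hd : T.card ≤ d) :
    2 * (finrank K (logPart T (fun _ => 1) d) : ℤ) = 3 * ((d + 1) * (d + 2)) -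
      2 * T.card * (d + 1) + T.card * (T.card - 1) - 2 * secondCoeff T := by
  classical
  have := FiniteDimensional.of_finrank_pos (K := K) (V := V) (by omega)
  induction T using Finset.induction_on with
  | empty =>
    have h1 : logPart (∅ : Finset (Submodule K V)) (fun _ => 1) d = homogeneous K V d := by
      refine le_antisymm inf_le_right fun φ hφ => ⟨?_, hφ⟩
      intro H hH
      simp at hH
    have h2 := finrank_homogeneousPart_of_finrank_three hV d
    have h3 : secondCoeff (∅ : Finset (Submodule K V)) = 0 := by simp [secondCoeff, pairFlats]
    rw [h1, finrank_homogeneous, hV, h3]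
    push_cast
    zify at h2
    simp only [Finset.card_empty]
    push_cast
    linarith
  | insert H T hHT ih =>
    have hT' : ∀ H ∈ T, finrank K (V ⧸ H) = 1 := fun H' h => hT H' (Finset.mem_insert_of_mem h)
    have hH := hT H (Finset.mem_insert_self _ _)
    rw [Finset.card_insert_of_notMem hHT] at hd
    have h1 := finrank_logPart_insert hV hT' hH hHT (d := d) (by omega)
    have h2 := ih hT' (by omega)
    have h3 := card_restrictions_le (T := T) (H := H)
    rw [secondCoeff_insert hV hT' hH hHT, Finset.card_insert_of_notMem hHT]
    have h4 : (finrank K (logPart (insert H T) (fun _ => 1) d) : ℤ) =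
      finrank K (logPart T (fun _ => 1) d) - (d + 1 - (T.card - (restrictions T H).card)) := by
      omega
    rw [h4, mul_sub, h2]
    push_cast
    ring

end

noncomputable section

/-! ### The characteristic polynomial -/

namespace Arrangement

variable {K V : Type*} [Field K] [AddCommGroup V] [Module K V] (A : Arrangement K V)

theorem mem_flats {X : Submodule K V} : X ∈ A.flats ↔ ∃ B ⊆ A.hyperplanes, B.inf id = X := by
  classical
  simp [flats]

theorem top_mem_flats : ⊤ ∈ A.flats := A.mem_flats.mpr ⟨∅, by simp, by simp⟩

open Classical in
/-- The Möbius function, as a function on all subspaces. -/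
def moebiusFun (X : Submodule K V) : ℤ :=
  if h : X ∈ A.flats then A.moebius (OrderDual.toDual ⟨X, h⟩) else 0

theorem sum_intersectionLattice {M : Type*} [AddCommMonoid M] (g : Submodule K V → M) :
    ∑ F : A.IntersectionLattice, g (OrderDual.ofDual F).1 = ∑ X ∈ A.flats, g X := by
  rw [← Finset.sum_coe_sort A.flats g]
  exact Fintype.sum_equiv OrderDual.ofDual _ _ fun _ => rfl

theorem moebiusFun_ofDual (F : A.IntersectionLattice) :
    A.moebiusFun (OrderDual.ofDual F).1 = A.moebius F :=
  dif_pos (OrderDual.ofDual F).2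

theorem charPoly_eq_sum :
    A.charPoly = ∑ X ∈ A.flats, C (A.moebiusFun X) * Polynomial.X ^ finrank K X := by
  rw [← sum_intersectionLattice, charPoly]
  exact Finset.sum_congr rfl fun F _ => by rw [moebiusFun_ofDual]

open Classical in
theorem sum_moebiusFun {X : Submodule K V} (hX : X ∈ A.flats) :
    ∑ Y ∈ A.flats with X ≤ Y, A.moebiusFun Y = if X = ⊤ then 1 else 0 := by
  rw [Finset.sum_filter, ← sum_intersectionLattice A fun Y => if X ≤ Y then A.moebiusFun Y else 0,
    ← Finset.sum_filter]
  have h := IncidenceAlgebra.sum_Icc_mu_right (𝕜 := ℤ) A.minFlat (OrderDual.toDual ⟨X, hX⟩)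
  have h1 : (A.minFlat = OrderDual.toDual ⟨X, hX⟩) ↔ X = ⊤ := by
    change OrderDual.toDual (⟨⊤, A.top_mem_flats⟩ : {X // X ∈ A.flats}) = _ ↔ _
    rw [OrderDual.toDual_inj, Subtype.mk.injEq, eq_comm]
  rw [if_congr h1 rfl rfl] at h
  rw [← h]
  refine Finset.sum_congr ?_ fun F _ => moebiusFun_ofDual A F
  ext F
  rw [Finset.mem_filter, Finset.mem_Icc]
  constructor
  · rintro ⟨-, h⟩
    exact ⟨show (OrderDual.ofDual F).1 ≤ ⊤ from le_top, h⟩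
  · rintro ⟨-, h⟩
    exact ⟨Finset.mem_univ _, h⟩

theorem mem_flats_of_mem {H : Submodule K V} (hH : H ∈ A.hyperplanes) : H ∈ A.flats :=
  A.mem_flats.mpr ⟨{H}, by simpa using hH, by simp⟩

theorem mem_flats_of_mem_pairFlats {X : Submodule K V} (hX : X ∈ pairFlats A.hyperplanes) :
    X ∈ A.flats := by
  classical
  obtain ⟨H, hH, H', hH', -, rfl⟩ := mem_pairFlats.mp hX
  refine A.mem_flats.mpr ⟨{H, H'}, ?_, by simp⟩
  intro Y hY
  rw [Finset.mem_insert, Finset.mem_singleton] at hY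
  rcases hY with rfl | rfl <;> assumption

theorem exists_le_of_mem_flats {X : Submodule K V} (hX : X ∈ A.flats) (hne : X ≠ ⊤) :
    ∃ H ∈ A.hyperplanes, X ≤ H := by
  obtain ⟨B, hB, rfl⟩ := A.mem_flats.mp hX
  obtain ⟨H, hH⟩ : B.Nonempty := by
    rw [Finset.nonempty_iff_ne_empty]
    rintro rfl
    simp at hne
  exact ⟨H, hB hH, Finset.inf_le (f := id) hH⟩

variable (hV : finrank K V = 3)
include hV

theorem finrank_of_mem {H : Submodule K V} (hH : H ∈ A.hyperplanes) : finrank K H = 2 := by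
  have := FiniteDimensional.of_finrank_pos (K := K) (V := V) (by omega)
  have := finrank_add_one_of_finrank_quotient (A.codim_one H hH)
  omega

theorem eq_top_of_finrank {X : Submodule K V} (h : finrank K X = 3) : X = ⊤ := by
  have := FiniteDimensional.of_finrank_pos (K := K) (V := V) (by omega)
  exact Submodule.eq_top_of_finrank_eq (by omega)

theorem mem_of_finrank_two {X : Submodule K V} (hX : X ∈ A.flats) (h : finrank K X = 2) :
    X ∈ A.hyperplanes := by
  have := FiniteDimensional.of_finrank_pos (K := K) (V := V) (by omega)
  obtain ⟨H, hH, hle⟩ := A.exists_le_of_mem_flats hX (by rintro rfl; rw [finrank_top] at h; omega)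
  rwa [Submodule.eq_of_le_of_finrank_eq hle (by rw [h, A.finrank_of_mem hV hH])]

theorem mem_pairFlats_of_finrank_one {X : Submodule K V} (hX : X ∈ A.flats)
    (h : finrank K X = 1) : X ∈ pairFlats A.hyperplanes := by
  have := FiniteDimensional.of_finrank_pos (K := K) (V := V) (by omega)
  obtain ⟨B, hB, hBX⟩ := A.mem_flats.mp hX
  obtain ⟨H, hH, hle⟩ : ∃ H ∈ B, X ≤ H := by
    obtain ⟨H, hH⟩ : B.Nonempty := by
      rw [Finset.nonempty_iff_ne_empty]
      rintro rfl
      rw [Finset.inf_empty] at hBX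
      rw [← hBX, finrank_top] at h
      omega
    exact ⟨H, hH, hBX ▸ Finset.inf_le (f := id) hH⟩
  obtain ⟨H', hH', hne⟩ : ∃ H' ∈ B, H' ≠ H := by
    by_contra! hall
    have : H ≤ X := by
      rw [← hBX]
      exact Finset.le_inf fun H' hH' => (hall H' hH').ge
    have h2 := A.finrank_of_mem hV (hB hH)
    rw [le_antisymm this hle] at h2
    omega
  refine mem_pairFlats_of_one_lt hV A.codim_one h (Finset.one_lt_card.mpr
    ⟨H, mem_above.mpr ⟨hB hH, hle⟩, H', mem_above.mpr ⟨hB hH', ?_⟩, hne.symm⟩)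
  exact hBX ▸ Finset.inf_le (f := id) hH'

omit hV in
theorem moebiusFun_top : A.moebiusFun ⊤ = 1 := by
  classical
  have h := A.sum_moebiusFun A.top_mem_flats
  have h1 : A.flats.filter (fun Y => ⊤ ≤ Y) = {⊤} := by
    ext Y
    simp only [Finset.mem_filter, top_le_iff, Finset.mem_singleton]
    exact ⟨fun h => h.2, fun h => ⟨h ▸ A.top_mem_flats, h⟩⟩
  rwa [h1, Finset.sum_singleton, if_pos rfl] at h

theorem moebiusFun_of_mem {H : Submodule K V} (hH : H ∈ A.hyperplanes) :
    A.moebiusFun H = -1 := by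
  classical
  have := FiniteDimensional.of_finrank_pos (K := K) (V := V) (by omega)
  have hH2 := A.finrank_of_mem hV hH
  have hne : H ≠ ⊤ := by
    rintro rfl
    rw [finrank_top] at hH2
    omega
  have h := A.sum_moebiusFun (A.mem_flats_of_mem hH)
  have h1 : A.flats.filter (fun Y => H ≤ Y) = {⊤, H} := by
    ext Y
    simp only [Finset.mem_filter, Finset.mem_insert, Finset.mem_singleton]
    constructor
    · rintro ⟨hY, hle⟩
      by_contra! h
      obtain ⟨H', hH', hle'⟩ := A.exists_le_of_mem_flats hY h.1
      have := eq_of_hyperplane_le (A.codim_one H hH) (A.codim_one H' hH') (hle.trans hle')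
      exact h.2 (le_antisymm (this ▸ hle') hle)
    · rintro (rfl | rfl)
      exacts [⟨A.top_mem_flats, le_top⟩, ⟨A.mem_flats_of_mem hH, le_rfl⟩]
  rw [h1, Finset.sum_pair hne.symm, if_neg hne, moebiusFun_top] at h
  omega

/-- The flats containing `X` are `V`, the members of `A` through `X`, and `X`, so the Möbius values
1, -1 for each member, and `μ(X)` sum to 0. -/
theorem moebiusFun_of_mem_pairFlats {X : Submodule K V} (hX : X ∈ pairFlats A.hyperplanes) :
    A.moebiusFun X = ((above A.hyperplanes X).card - 1 : ℕ) := by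
  classical
  have := FiniteDimensional.of_finrank_pos (K := K) (V := V) (by omega)
  have hX1 := finrank_of_mem_pairFlats hV A.codim_one hX
  have hne : X ≠ ⊤ := by
    rintro rfl
    rw [finrank_top] at hX1
    omega
  have hXA : X ∉ above A.hyperplanes X := fun h => by
    have := A.finrank_of_mem hV (mem_above.mp h).1
    omega
  have htop : ⊤ ∉ insert X (above A.hyperplanes X) := by
    rw [Finset.mem_insert, not_or]
    refine ⟨hne.symm, fun h => ?_⟩
    have := A.finrank_of_mem hV (mem_above.mp h).1
    rw [finrank_top] at this
    omega
  have h := A.sum_moebiusFun (A.mem_flats_of_mem_pairFlats hX)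
  have h1 : A.flats.filter (fun Y => X ≤ Y) = insert ⊤ (insert X (above A.hyperplanes X)) := by
    ext Y
    simp only [Finset.mem_filter, Finset.mem_insert, mem_above]
    constructor
    · rintro ⟨hY, hle⟩
      by_cases hYX : X = Y
      · exact Or.inr (Or.inl hYX.symm)
      · have h2 := Submodule.finrank_lt_finrank_of_lt (lt_of_le_of_ne hle hYX)
        have h3 := Submodule.finrank_le Y
        rcases (by omega : finrank K Y = 3 ∨ finrank K Y = 2) with h4 | h4
        · exact Or.inl (eq_top_of_finrank hV h4)
        · exact Or.inr (Or.inr ⟨A.mem_of_finrank_two hV hY h4, hle⟩)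
    · rintro (rfl | rfl | ⟨hY, hle⟩)
      exacts [⟨A.top_mem_flats, le_top⟩, ⟨A.mem_flats_of_mem_pairFlats hX, le_rfl⟩,
        ⟨A.mem_flats_of_mem hY, hle⟩]
  rw [h1, Finset.sum_insert htop, Finset.sum_insert hXA, if_neg hne, moebiusFun_top,
    Finset.sum_congr rfl fun Y hY => A.moebiusFun_of_mem hV (mem_above.mp hY).1,
    Finset.sum_const, nsmul_eq_mul] at h
  obtain ⟨H, hH, H', hH', hne', hHX⟩ := mem_pairFlats.mp hX
  have hpos : 0 < (above A.hyperplanes X).card :=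
    Finset.card_pos.mpr ⟨H, mem_above.mpr ⟨hH, hHX ▸ inf_le_left⟩⟩
  omega

omit hV in
-- Möbius recursion at the center of the arrangement, which is contained in every flat. It says that
-- χ vanishes at 1.
theorem sum_moebiusFun_flats {H : Submodule K V} (hH : H ∈ A.hyperplanes) :
    ∑ X ∈ A.flats, A.moebiusFun X = 0 := by
  classical
  have hZ : A.hyperplanes.inf id ∈ A.flats := A.mem_flats.mpr ⟨_, subset_rfl, rfl⟩
  have h := A.sum_moebiusFun hZ
  rw [if_neg, Finset.filter_true_of_mem] at h
  · exact h
  · intro Y hY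
    obtain ⟨B, hB, rfl⟩ := A.mem_flats.mp hY
    exact Finset.inf_mono hB
  · intro htop
    have hle : A.hyperplanes.inf id ≤ H := Finset.inf_le (f := id) hH
    rw [htop, top_le_iff] at hle
    exact form_ne_zero (A.codim_one H hH) (LinearMap.ker_eq_top.mp
      ((ker_form (A.codim_one H hH)).trans hle))

/-- Group the flats by dimension. The constant term is obtained from χ(1) = 0, so it need not be
known whether `{0}` is a flat. -/
theorem charPoly_eq {H : Submodule K V} (hH : H ∈ A.hyperplanes) :
    A.charPoly = X ^ 3 - C (A.hyperplanes.card : ℤ) * X ^ 2 +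
      C (secondCoeff A.hyperplanes : ℤ) * X -
      C (1 - A.hyperplanes.card + secondCoeff A.hyperplanes : ℤ) := by
  classical
  have := FiniteDimensional.of_finrank_pos (K := K) (V := V) (by omega)
  have hmaps : ∀ X ∈ A.flats, finrank K X ∈ Finset.range 4 := fun X _ => by
    have := Submodule.finrank_le X
    rw [Finset.mem_range]
    omega
  have h3 : A.flats.filter (fun X : Submodule K V => finrank K X = 3) = {⊤} := by
    ext X
    simp only [Finset.mem_filter, Finset.mem_singleton]
    constructor
    · exact fun h => eq_top_of_finrank hV h.2
    · rintro rfl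
      exact ⟨A.top_mem_flats, by rw [finrank_top, hV]⟩
  have h2 : A.flats.filter (fun X : Submodule K V => finrank K X = 2) = A.hyperplanes := by
    ext X
    rw [Finset.mem_filter]
    exact ⟨fun h => A.mem_of_finrank_two hV h.1 h.2,
      fun h => ⟨A.mem_flats_of_mem h, A.finrank_of_mem hV h⟩⟩
  have h1 : A.flats.filter (fun X : Submodule K V => finrank K X = 1) =
      pairFlats A.hyperplanes := by
    ext X
    rw [Finset.mem_filter]
    exact ⟨fun h => A.mem_pairFlats_of_finrank_one hV h.1 h.2,
      fun h => ⟨A.mem_flats_of_mem_pairFlats h, finrank_of_mem_pairFlats hV A.codim_one h⟩⟩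
  set c : ℕ → ℤ := fun k => ∑ X ∈ A.flats.filter fun X : Submodule K V => finrank K X = k,
    A.moebiusFun X with hc
  have hc3 : c 3 = 1 := by rw [hc]; simp only [h3, Finset.sum_singleton, moebiusFun_top]
  have hc2 : c 2 = -A.hyperplanes.card := by
    rw [hc]
    simp only [h2]
    rw [Finset.sum_congr rfl fun X hX => A.moebiusFun_of_mem hV hX, Finset.sum_const,
      nsmul_eq_mul, mul_neg_one]
  have hc1 : c 1 = secondCoeff A.hyperplanes := by
    rw [hc]
    simp only [h1]
    rw [Finset.sum_congr rfl fun X hX => A.moebiusFun_of_mem_pairFlats hV hX, secondCoeff,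
      Nat.cast_sum]
  have hsum : c 0 + c 1 + c 2 + c 3 = 0 := by
    have h := Finset.sum_fiberwise_of_maps_to hmaps A.moebiusFun
    rw [A.sum_moebiusFun_flats hH, Finset.sum_range_succ, Finset.sum_range_succ,
      Finset.sum_range_succ, Finset.sum_range_succ, Finset.sum_range_zero, zero_add] at h
    exact h
  have hpoly : A.charPoly = ∑ k ∈ Finset.range 4, C (c k) * X ^ k := by
    rw [charPoly_eq_sum, ← Finset.sum_fiberwise_of_maps_to hmaps]
    refine Finset.sum_congr rfl fun k _ => ?_
    rw [hc, map_sum, Finset.sum_mul]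
    exact Finset.sum_congr rfl fun X hX => by rw [(Finset.mem_filter.mp hX).2]
  have hc0 : c 0 = -(1 - A.hyperplanes.card + secondCoeff A.hyperplanes) := by
    rw [hc1, hc2, hc3] at hsum
    linarith
  rw [hpoly, Finset.sum_range_succ, Finset.sum_range_succ, Finset.sum_range_succ,
    Finset.sum_range_succ, Finset.sum_range_zero, hc0, hc1, hc2, hc3]
  simp only [map_neg, map_one]
  ring

theorem charPoly_eq_iff {H : Submodule K V} (hH : H ∈ A.hyperplanes) {d₂ d₃ : ℕ}
    (h : d₂ + d₃ + 1 = A.hyperplanes.card) :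
    A.charPoly = (X - 1) * (X - C (d₂ : ℤ)) * (X - C (d₃ : ℤ)) ↔
      secondCoeff A.hyperplanes = d₂ + d₃ + d₂ * d₃ := by
  rw [A.charPoly_eq hV hH, ← h]
  constructor
  · intro h
    -- The two cubics share their two leading coefficients and the root 1, so their difference is a
    -- constant times `X - 1`; evaluation at 2 isolates this constant.
    have := congrArg (Polynomial.eval 2) h
    simp at this
    zify
    linarith
  · intro h
    rw [h]
    push_cast
    simp only [map_add, map_sub, map_mul, map_one]
    ring

end Arrangement

end

noncomputable section

open PolyFun FormField

variable {K V : Type*} [Field K] [AddCommGroup V] [Module K V]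

/-! ### The restriction map -/

variable (H : Submodule K V)

/-- Restriction of vector fields to a subspace, by means of the chosen extension of linear forms.
-/
def restrictField : FormField K V →ₗ[K] FormField K H where
  toFun φ := (res H).toLinearMap ∘ₗ φ ∘ₗ extendForm H
  map_add' φ ψ := by ext α : 1; simp
  map_smul' c φ := by ext α : 1; simp

theorem restrictField_apply (φ : FormField K V) (α : Dual K H) :
    restrictField H φ α = res H (φ (extendForm H α)) := rfl

theorem restrictField_smul (f : PolyFun K V) (φ : FormField K V) :
    restrictField H (f • φ) = res H f • restrictField H φ := by
  ext α : 1
  simp [restrictField_apply]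

theorem restrictField_component (d : ℕ) (φ : FormField K V) :
    restrictField H (component d φ) = component d (restrictField H φ) := by
  ext α : 1
  rw [component_apply, restrictField_apply, restrictField_apply, comp_res, component_apply]

theorem restrictField_mem_homogeneous {d : ℕ} {φ : FormField K V} (h : φ ∈ homogeneous K V d) :
    restrictField H φ ∈ homogeneous K H d :=
  fun _ => res_mem H (h _)

variable {H}

/-- Two extensions of a form on `H` differ by a multiple of `α_H`, which `φ` kills; so the
restriction does not depend on the chosen extension. -/
theorem restrictField_restrict (hH : finrank K (V ⧸ H) = 1) {φ : FormField K V}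
    (h : φ (form H) = 0) (γ : Dual K V) :
    restrictField H φ (H.subtype.dualMap γ) = res H (φ γ) := by
  have hle : LinearMap.ker (form H) ≤
      LinearMap.ker (extendForm H (H.subtype.dualMap γ) - γ) := by
    rw [ker_form hH, ← restrict_eq_zero_iff, map_sub, restrict_extendForm, sub_self]
  obtain ⟨c, hc⟩ := exists_smul_of_ker_le hle
  rw [restrictField_apply, eq_add_of_sub_eq hc, map_add, map_smul, h, smul_zero, zero_add]

/-- The fields that are logarithmic along `T` and kill the equation of `H`. -/
def relFields (T : Finset (Submodule K V)) (H : Submodule K V) :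
    Submodule (PolyFun K V) (FormField K V) :=
  logFields T (fun _ => 1) ⊓ LinearMap.ker (FormField.eval (form H))

/-- The multiplicities of the restriction of `T` to `H`. -/
def fiberMult (T : Finset (Submodule K V)) (H : Submodule K V) (X : Submodule K H) : ℕ :=
  (fiber T X).card

variable {T : Finset (Submodule K V)}

theorem mem_relFields {φ : FormField K V} :
    φ ∈ relFields T H ↔ φ ∈ logFields T (fun _ => 1) ∧ φ (form H) = 0 := Iff.rfl

theorem component_mem_relFields {φ : FormField K V} (h : φ ∈ relFields T H) (d : ℕ) :
    component d φ ∈ relFields T H :=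
  mem_relFields.mpr ⟨component_mem_logFields h.1 d, by
    rw [component_apply, (mem_relFields.mp h).2, map_zero]⟩

theorem restrictField_mem (hT : ∀ H' ∈ T, finrank K (V ⧸ H') = 1)
    (hH : finrank K (V ⧸ H) = 1) (hHT : H ∉ T) {φ : FormField K V} (hφ : φ ∈ relFields T H) :
    restrictField H φ ∈ logFields (restrictions T H) (fiberMult T H) := by
  intro X hX α hα
  have := pow_card_fiber_dvd_res hT hH hHT (mem_relFields.mp hφ).1 (mem_relFields.mp hφ).2 hX
    (γ := extendForm H α) (by rw [restrict_extendForm, hα])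
  rwa [restrict_extendForm] at this

theorem exists_eq_smul_of_dvd {f : PolyFun K V} (hf : f ≠ 0) {φ : FormField K V}
    (h : ∀ α, f ∣ φ α) : ∃ ψ : FormField K V, φ = f • ψ := by
  choose q hq using h
  refine ⟨⟨⟨q, fun α β => ?_⟩, fun c α => ?_⟩, LinearMap.ext hq⟩
  · apply mul_left_cancel₀ hf
    rw [← hq, map_add, mul_add, ← hq, ← hq]
  · apply mul_left_cancel₀ hf
    rw [← hq, map_smul, RingHom.id_apply, mul_smul_comm, ← hq]

/-- All values of `φ` vanish on `H`, so `φ` can be divided by `α_H`. The quotient stays tangent to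
`T`, because the equations of `T` are primes not dividing `α_H`. -/
theorem exists_of_restrictField_eq_zero (hT : ∀ H' ∈ T, finrank K (V ⧸ H') = 1)
    (hH : finrank K (V ⧸ H) = 1) (hHT : H ∉ T) {φ : FormField K V} (hφ : φ ∈ relFields T H)
    (h : restrictField H φ = 0) : ∃ ψ ∈ relFields T H, φ = linForm K V (form H) • ψ := by
  have hp := prime_form hH
  rw [mem_relFields] at hφ
  obtain ⟨ψ, rfl⟩ := exists_eq_smul_of_dvd hp.ne_zero (φ := φ) fun γ => by
    rw [← res_eq_zero_iff (ker_form hH), ← restrictField_restrict hH hφ.2, h,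
      LinearMap.zero_apply]
  refine ⟨ψ, mem_relFields.mpr ⟨(mem_logFields_iff_form hT).mpr fun H' hH' => ?_, ?_⟩, rfl⟩
  · have h1 := hφ.1 H' hH' _ (ker_form (hT H' hH'))
    rw [pow_one] at h1 ⊢
    exact ((prime_form (hT H' hH')).dvd_or_dvd h1).resolve_left
      (form_not_dvd (hT H' hH') hH fun h => hHT (h ▸ hH'))
  · exact (mul_eq_zero.mp hφ.2).resolve_left hp.ne_zero

theorem restrictField_form_smul (hH : finrank K (V ⧸ H) = 1) (φ : FormField K V) :
    restrictField H (linForm K V (form H) • φ) = 0 := by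
  rw [restrictField_smul, (res_eq_zero_iff (ker_form hH)).mpr dvd_rfl, zero_smul]

/-! ### Dimension counts for the restriction sequence -/

/-- The homogeneous part of degree `d` of `relFields T H`. -/
def relPart (T : Finset (Submodule K V)) (H : Submodule K V) (d : ℕ) :
    Submodule K (FormField K V) :=
  (relFields T H).restrictScalars K ⊓ homogeneous K V d

instance [FiniteDimensional K V] (d : ℕ) : FiniteDimensional K (relPart T H d) :=
  Submodule.finiteDimensional_of_le (inf_le_right : _ ≤ homogeneous K V d)

/-- The restrictions to `H` of the fields in `relPart T H d`. -/
def imagePart (T : Finset (Submodule K V)) (H : Submodule K V) (d : ℕ) :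
    Submodule K (FormField K H) :=
  (relPart T H d).map (restrictField H)

theorem imagePart_le (hT : ∀ H' ∈ T, finrank K (V ⧸ H') = 1)
    (hH : finrank K (V ⧸ H) = 1) (hHT : H ∉ T) (d : ℕ) :
    imagePart T H d ≤ logPart (restrictions T H) (fiberMult T H) d := by
  rintro _ ⟨φ, ⟨h1, h2⟩, rfl⟩
  exact ⟨restrictField_mem hT hH hHT h1, restrictField_mem_homogeneous H h2⟩

theorem finrank_map_add_finrank_inf_ker {M N : Type*} [AddCommGroup M] [Module K M]
    [AddCommGroup N] [Module K N] (P : Submodule K M) [FiniteDimensional K P] (f : M →ₗ[K] N) :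
    finrank K (P.map f) + finrank K ↥(P ⊓ LinearMap.ker f) = finrank K P := by
  have h := LinearMap.finrank_range_add_finrank_ker (f.domRestrict P)
  rw [LinearMap.range_domRestrict] at h
  rw [← h, LinearMap.ker_domRestrict, ← Submodule.map_comap_subtype P,
    Submodule.finrank_map_subtype_eq]

/-- Multiplication of vector fields by a polynomial function, as a linear map over `K`. -/
def mulField (f : PolyFun K V) : FormField K V →ₗ[K] FormField K V where
  toFun φ := f • φ
  map_add' φ ψ := smul_add f φ ψ
  map_smul' c φ := smul_comm f c φ

theorem smul_left_injective_field {f : PolyFun K V} (hf : f ≠ 0) {φ ψ : FormField K V}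
    (h : f • φ = f • ψ) : φ = ψ :=
  LinearMap.ext fun α => mul_left_cancel₀ hf (LinearMap.congr_fun h α)

theorem finrank_relPart_zero [FiniteDimensional K V] (hT : ∀ H' ∈ T, finrank K (V ⧸ H') = 1)
    (hH : finrank K (V ⧸ H) = 1) (hHT : H ∉ T) :
    finrank K (relPart T H 0) = finrank K (imagePart T H 0) := by
  have hker : relPart T H 0 ⊓ LinearMap.ker (restrictField H) = ⊥ := by
    rw [eq_bot_iff]
    rintro φ ⟨⟨h1, h2⟩, h3⟩
    obtain ⟨ψ, -, rfl⟩ := exists_of_restrictField_eq_zero hT hH hHT h1 h3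
    rw [Submodule.mem_bot]
    ext α : 1
    by_contra hne
    have := le_of_mul_mem (linForm_mem (form H)) hne (h2 α)
    omega
  have h := finrank_map_add_finrank_inf_ker (relPart T H 0) (restrictField H)
  rw [hker, finrank_bot] at h
  exact h.symm

/-- Exactness of 0 → D₀ → D₀ → image → 0 by degrees, where the first map is multiplication by `α_H`
and raises the degree by one. -/
theorem finrank_relPart_succ [FiniteDimensional K V] (hT : ∀ H' ∈ T, finrank K (V ⧸ H') = 1)
    (hH : finrank K (V ⧸ H) = 1) (hHT : H ∉ T) (d : ℕ) :
    finrank K (relPart T H (d + 1)) =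
      finrank K (imagePart T H (d + 1)) + finrank K (relPart T H d) := by
  have h0 := (prime_form hH).ne_zero
  have hker : relPart T H (d + 1) ⊓ LinearMap.ker (restrictField H) =
      (relPart T H d).map (mulField (linForm K V (form H))) := by
    ext φ
    constructor
    · rintro ⟨⟨h1, h2⟩, h3⟩
      obtain ⟨ψ, hψ, rfl⟩ := exists_of_restrictField_eq_zero hT hH hHT h1 h3
      refine ⟨ψ, ⟨hψ, fun α => ?_⟩, rfl⟩
      have := h2 α
      rw [add_comm] at this
      exact mem_of_mul_mem (linForm_mem (form H)) h0 this
    · rintro ⟨ψ, ⟨h1, h2⟩, rfl⟩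
      refine ⟨⟨Submodule.smul_mem (relFields T H) _ h1, ?_⟩, restrictField_form_smul hH ψ⟩
      have := smul_mem_homogeneous (linForm_mem (form H)) h2
      rwa [add_comm] at this
  have h := finrank_map_add_finrank_inf_ker (relPart T H (d + 1)) (restrictField H)
  rw [hker, ← (Submodule.equivMapOfInjective (mulField (linForm K V (form H)))
    (fun φ ψ => smul_left_injective_field h0) _).finrank_eq] at h
  exact h.symm

theorem sum_finrank_imagePart [FiniteDimensional K V] (hT : ∀ H' ∈ T, finrank K (V ⧸ H') = 1)
    (hH : finrank K (V ⧸ H) = 1) (hHT : H ∉ T) (d : ℕ) :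
    ∑ i ∈ Finset.range (d + 1), finrank K (imagePart T H i) = finrank K (relPart T H d) := by
  induction d with
  | zero => rw [Finset.sum_range_one, finrank_relPart_zero hT hH hHT]
  | succ d ih => rw [Finset.sum_range_succ, ih, finrank_relPart_succ hT hH hHT, add_comm]

-- If `φ(α_H) = f α_H`, then `φ - f θ`, with `θ` the Euler field, kills `α_H` and stays tangent to
-- `T`. The summand along the Euler field is a free direct factor.
open Classical in
theorem mem_logFields_insert_iff (hH : finrank K (V ⧸ H) = 1) {φ : FormField K V} :
    φ ∈ logFields (insert H T) (fun _ => 1) ↔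
      ∃ ψ ∈ relFields T H, ∃ f : PolyFun K V, φ = ψ + f • linForm K V := by
  rw [mem_logFields_insert hH, res_eq_zero_iff (ker_form hH)]
  constructor
  · rintro ⟨h, f, hf⟩
    refine ⟨φ - f • linForm K V, mem_relFields.mpr
      ⟨sub_mem h (Submodule.smul_mem _ _ (linForm_mem_logFields T)), ?_⟩, f, by abel⟩
    rw [LinearMap.sub_apply, LinearMap.smul_apply, hf, smul_eq_mul, mul_comm, sub_self]
  · rintro ⟨ψ, hψ, f, rfl⟩
    refine ⟨add_mem hψ.1 (Submodule.smul_mem _ _ (linForm_mem_logFields T)), ?_⟩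
    rw [LinearMap.add_apply, (mem_relFields.mp hψ).2, zero_add]
    exact dvd_mul_left _ _

open Classical in
theorem finrank_logPart_insert_succ [FiniteDimensional K V] (hH : finrank K (V ⧸ H) = 1) (d : ℕ) :
    finrank K (logPart (insert H T) (fun _ => 1) (d + 1)) =
      finrank K (relPart T H (d + 1)) + finrank K (homogeneousPart K V d) := by
  have h0 := (prime_form hH).ne_zero
  let ev : FormField K V →ₗ[K] PolyFun K V := LinearMap.applyₗ (form H)
  have h := finrank_map_add_finrank_inf_ker (logPart (insert H T) (fun _ => 1) (d + 1)) ev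
  have hker : logPart (insert H T) (fun _ => 1) (d + 1) ⊓ LinearMap.ker ev =
      relPart T H (d + 1) := by
    ext φ
    constructor
    · rintro ⟨⟨h1, h2⟩, h3⟩
      exact ⟨mem_relFields.mpr ⟨((mem_logFields_insert hH).mp h1).1, h3⟩, h2⟩
    · rintro ⟨h1, h2⟩
      exact ⟨⟨(mem_logFields_insert_iff hH).mpr ⟨φ, h1, 0, by simp⟩, h2⟩,
        (mem_relFields.mp h1).2⟩
  have hmap : (logPart (insert H T) (fun _ => 1) (d + 1)).map ev =
      (homogeneousPart K V d).map (LinearMap.mulLeft K (linForm K V (form H))) := by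
    ext f
    constructor
    · rintro ⟨φ, ⟨h1, h2⟩, rfl⟩
      obtain ⟨q, hq⟩ := (res_eq_zero_iff (ker_form hH)).mp ((mem_logFields_insert hH).mp h1).2
      refine ⟨q, mem_of_mul_mem (linForm_mem (form H)) h0 ?_, hq.symm⟩
      rw [← hq, add_comm]
      exact h2 _
    · rintro ⟨q, hq, rfl⟩
      refine ⟨q • linForm K V, ⟨(mem_logFields_insert_iff hH).mpr ⟨0, zero_mem _, q, by simp⟩,
        smul_mem_homogeneous hq linForm_mem_homogeneous⟩, ?_⟩
      exact mul_comm _ _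
  rw [hker, hmap, ← (Submodule.equivMapOfInjective _
    (mul_right_injective₀ h0 :
      Function.Injective (LinearMap.mulLeft K (linForm K V (form H)))) _).finrank_eq] at h
  rw [← h, add_comm]

theorem two_mul_sum_range_sub (e d : ℕ) (h : e ≤ d) :
    2 * ∑ i ∈ Finset.range d, (i + 1 - e) = (d - e) * (d + 1 - e) := by
  obtain ⟨k, rfl⟩ := Nat.exists_eq_add_of_le h
  induction k with
  | zero =>
    simp only [add_zero, tsub_self, zero_mul, mul_eq_zero, OfNat.ofNat_ne_zero, false_or,
      Finset.sum_eq_zero_iff, Finset.mem_range]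
    intro i hi
    omega
  | succ k ih =>
    rw [← add_assoc, Finset.sum_range_succ, mul_add, ih (by omega)]
    have h1 : e + k - e = k := by omega
    have h2 : e + k + 1 - e = k + 1 := by omega
    have h3 : e + k + 1 + 1 - e = k + 2 := by omega
    rw [h1, h2, h3]
    ring

/-! ### The total codimension of the image of restriction -/

section Comparison

variable (hV : finrank K V = 3) (hT : ∀ H' ∈ T, finrank K (V ⧸ H') = 1)
  (hH : finrank K (V ⧸ H) = 1) (hHT : H ∉ T) {d₂ d₃ : ℕ} {θ₂ θ₃ : FormField K H}
  (h₂ : θ₂ ∈ homogeneous K H d₂) (h₃ : θ₃ ∈ homogeneous K H d₃)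
  (hb : IsPairBasis (logFields (restrictions T H) (fiberMult T H)) θ₂ θ₃)
include hV hH hT hHT h₂ h₃ hb

theorem exponents_add : d₂ + d₃ = T.card := by
  have := FiniteDimensional.of_finrank_pos (K := K) (V := V) (by omega)
  have hH2 := finrank_add_one_of_finrank_quotient hH
  rw [add_eq_of_isPairBasis (by omega)
    (fun X hX => finrank_quotient_of_mem_restrictions hT hH hHT hX) h₂ h₃ hb]
  exact sum_card_fiber

open Classical in
/-- The total codimension of the image of the restriction map. -/
theorem sum_codim {d : ℕ} (hd : T.card + 1 ≤ d) :
    ∑ i ∈ Finset.range (d + 1), ((finrank K (logPart (restrictions T H) (fiberMult T H) i) : ℤ) -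
      finrank K (imagePart T H i)) =
      secondCoeff (insert H T) - (d₂ + d₃ + d₂ * d₃) := by
  have := FiniteDimensional.of_finrank_pos (K := K) (V := V) (by omega)
  have hH2 := finrank_add_one_of_finrank_quotient hH
  have hsum := exponents_add hV hT hH hHT h₂ h₃ hb
  obtain ⟨e, rfl⟩ : ∃ e, d = e + 1 := ⟨d - 1, by omega⟩
  have hT' : ∀ H' ∈ insert H T, finrank K (V ⧸ H') = 1 := by
    intro H' hH'
    rcases Finset.mem_insert.mp hH' with rfl | h
    exacts [hH, hT H' h]
  have hcard : (insert H T).card = d₂ + d₃ + 1 := by rw [Finset.card_insert_of_notMem hHT, hsum]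
  -- Together with `hS` and `hI` this evaluates the sum of the image dimensions. It and the sum in
  -- `hL` are quadratic in the degree with the same nonconstant terms, so only a constant survives.
  have hA := finrank_logPart hV hT' (d := e + 1) (by omega)
  rw [finrank_logPart_insert_succ hH, hcard] at hA
  have hS := finrank_homogeneousPart_of_finrank_three hV e
  have hI := sum_finrank_imagePart hT hH hHT (e + 1)
  have hL : ∑ i ∈ Finset.range (e + 1 + 1),
      finrank K (logPart (restrictions T H) (fiberMult T H) i) =
      ∑ i ∈ Finset.range (e + 1 + 1), (i + 1 - d₂) +
        ∑ i ∈ Finset.range (e + 1 + 1), (i + 1 - d₃) := by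
    rw [← Finset.sum_add_distrib]
    exact Finset.sum_congr rfl fun i _ => finrank_logPart_of_isPairBasis (by omega) h₂ h₃ hb i
  have s₂ := two_mul_sum_range_sub d₂ (e + 1 + 1) (by omega)
  have s₃ := two_mul_sum_range_sub d₃ (e + 1 + 1) (by omega)
  rw [Finset.sum_sub_distrib, ← Nat.cast_sum, ← Nat.cast_sum, hI, hL]
  zify [show d₂ ≤ e + 1 + 1 by omega, show d₃ ≤ e + 1 + 1 by omega,
    show d₂ ≤ e + 1 + 1 + 1 by omega, show d₃ ≤ e + 1 + 1 + 1 by omega] at s₂ s₃ hS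
  push_cast at hA ⊢
  linarith

omit h₂ h₃ hb in
theorem imagePart_eq_iff (d : ℕ) :
    imagePart T H d = logPart (restrictions T H) (fiberMult T H) d ↔
      (finrank K (logPart (restrictions T H) (fiberMult T H) d) : ℤ) -
        finrank K (imagePart T H d) = 0 := by
  have := FiniteDimensional.of_finrank_pos (K := K) (V := V) (by omega)
  constructor
  · intro h
    rw [h, sub_self]
  · intro h
    exact Submodule.eq_of_le_of_finrank_eq (imagePart_le hT hH hHT d) (by omega)

omit h₂ h₃ hb in
theorem codim_nonneg (d : ℕ) :
    (0 : ℤ) ≤ finrank K (logPart (restrictions T H) (fiberMult T H) d) -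
        finrank K (imagePart T H d) := by
  have := FiniteDimensional.of_finrank_pos (K := K) (V := V) (by omega)
  have := Submodule.finrank_mono (imagePart_le hT hH hHT d)
  omega

-- The codimensions are nonnegative and their partial sums are eventually the constant of
-- `sum_codim`, so they all vanish exactly when this constant does.
open Classical in
theorem imagePart_eq_all_iff :
    (∀ d, imagePart T H d = logPart (restrictions T H) (fiberMult T H) d) ↔
      secondCoeff (insert H T) = d₂ + d₃ + d₂ * d₃ := by
  constructor
  · intro h
    have hs := sum_codim hV hT hH hHT h₂ h₃ hb le_rfl
    rw [Finset.sum_eq_zero fun i _ => (imagePart_eq_iff hV hT hH hHT i).mp (h i)] at hs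
    zify
    linarith
  · intro h d
    have hs := sum_codim hV hT hH hHT h₂ h₃ hb (d := d + T.card + 1) (by omega)
    rw [h] at hs
    push_cast at hs
    rw [sub_self, Finset.sum_eq_zero_iff_of_nonneg fun i _ => codim_nonneg hV hT hH hHT i] at hs
    exact (imagePart_eq_iff hV hT hH hHT d).mpr (hs d (Finset.mem_range.mpr (by omega)))

/-- The partial sums of the codimensions are constant from degree `T.card + 1` on, so every later
codimension is 0. -/
theorem imagePart_eq_of_card_lt {d : ℕ} (hd : T.card + 1 < d) :
    imagePart T H d = logPart (restrictions T H) (fiberMult T H) d := by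
  classical
  obtain ⟨e, rfl⟩ : ∃ e, d = e + 1 := ⟨d - 1, by omega⟩
  have h1 := sum_codim hV hT hH hHT h₂ h₃ hb (d := e) (by omega)
  have h2 := sum_codim hV hT hH hHT h₂ h₃ hb (d := e + 1) (by omega)
  rw [Finset.sum_range_succ, h1] at h2
  exact (imagePart_eq_iff hV hT hH hHT _).mpr (by linarith)

end Comparison

end

noncomputable section

open PolyFun FormField

variable {K V : Type*} [Field K] [AddCommGroup V] [Module K V]
variable {T : Finset (Submodule K V)} {H : Submodule K V}

/-! ### Freeness and surjectivity of the restriction map -/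

/-- The hypothesis on `x`, `y`, `z` says that `y f ∈ (x, z)`, witnessed by `g` and `h`, forces `f ∈
(x, z)`; in a free module it can be applied to each coordinate. -/
theorem Module.Free.exists_eq_smul_add_smul {R M : Type*} [CommRing R] [AddCommGroup M]
    [Module R M] [Module.Free R M] {x y z : R}
    (hreg : ∀ f g h : R, y * f - x * g = z * h → ∃ u w, f = x * u + z * w)
    {a b c : M} (h : y • a - x • b = z • c) : ∃ u w : M, a = x • u + z • w := by
  let B := Module.Free.chooseBasis R M
  have hcoord : ∀ i, ∃ u w, B.repr a i = x * u + z * w := fun i =>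
    hreg _ (B.repr b i) (B.repr c i) (by
      simpa using congrArg (fun m => B.repr m i) h)
  choose u w huw using hcoord
  refine ⟨∑ i ∈ (B.repr a).support, u i • B i, ∑ i ∈ (B.repr a).support, w i • B i, ?_⟩
  conv_lhs => rw [← B.linearCombination_repr a, Finsupp.linearCombination_apply, Finsupp.sum]
  rw [Finset.smul_sum, Finset.smul_sum, ← Finset.sum_add_distrib]
  exact Finset.sum_congr rfl fun i _ => by rw [huw, add_smul, mul_smul, mul_smul]

/-- Modulo `α` the relation reads `y f = x g` in K[H], where `x` is prime and does not divide `y`;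
so `x` divides `f` there. -/
theorem exists_eq_mul_add_mul {α : Dual K V} (hα : LinearMap.ker α = H) {x y : Dual K H}
    (hx : x ≠ 0)
    (hxy : ¬ LinearMap.ker x ≤ LinearMap.ker y) {f g h : PolyFun K V}
    (hfgh : linForm K V (extendForm H y) * f - linForm K V (extendForm H x) * g =
      linForm K V α * h) :
    ∃ u w, f = linForm K V (extendForm H x) * u + linForm K V α * w := by
  have h1 := congrArg (res H) hfgh
  rw [map_sub, map_mul, map_mul, map_mul, res_linForm, res_linForm, restrict_extendForm,
    restrict_extendForm, (res_eq_zero_iff hα).mpr dvd_rfl, zero_mul, sub_eq_zero] at h1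
  have hdvd : linForm K H x ∣ res H f :=
    ((prime_linForm hx).dvd_or_dvd ⟨_, h1⟩).resolve_left (mt linForm_dvd_iff.mp hxy)
  obtain ⟨q, hq⟩ := hdvd
  have h2 : res H (f - linForm K V (extendForm H x) * extend H q) = 0 := by
    rw [map_sub, map_mul, res_linForm, restrict_extendForm, res_extend, hq, sub_self]
  obtain ⟨w, hw⟩ := (res_eq_zero_iff hα).mp h2
  exact ⟨extend H q, w, by rw [← hw]; ring⟩

theorem exists_dual_not_ker_le (hH : 1 < finrank K H) :
    ∃ x y : Dual K H, x ≠ 0 ∧ ¬ LinearMap.ker x ≤ LinearMap.ker y := by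
  have := FiniteDimensional.of_finrank_pos (K := K) (V := H) (by omega)
  obtain ⟨x, hx⟩ := exists_dual_ne_zero (K := K) (V := H) (by omega)
  have h1 := finrank_ker_of_ne_zero hx
  have : LinearMap.ker x ≠ ⊥ := by
    intro h
    rw [h, finrank_bot] at h1
    omega
  obtain ⟨v, hv, hv0⟩ := Submodule.exists_mem_ne_zero_of_ne_bot this
  obtain ⟨y, hy⟩ := not_forall.mp (mt (Module.forall_dual_apply_eq_zero_iff K v).mp hv0)
  exact ⟨x, y, hx, fun h => hy (h hv)⟩

-- A depth argument. For `v` of degree `d`, lift `x v` and `y v` to `a` and `b`. Then `y a - x b`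
-- restricts to 0, so it is a multiple of `α_H`, and freeness yields `a = x u + α_H w`. Restricting
-- and cancelling `x`, one finds that `u` lifts `v`, once its Euler part is removed.
open Classical in
theorem imagePart_eq_of_succ (hV : finrank K V = 3) (hT : ∀ H' ∈ T, finrank K (V ⧸ H') = 1)
    (hH : finrank K (V ⧸ H) = 1) (hHT : H ∉ T)
    (hfree : Module.Free (PolyFun K V) (logFields (insert H T) fun _ => 1)) {d : ℕ}
    (hd : imagePart T H (d + 1) = logPart (restrictions T H) (fiberMult T H) (d + 1)) :
    imagePart T H d = logPart (restrictions T H) (fiberMult T H) d := by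
  have := FiniteDimensional.of_finrank_pos (K := K) (V := V) (by omega)
  have hH2 := finrank_add_one_of_finrank_quotient hH
  refine le_antisymm (imagePart_le hT hH hHT d) fun v hv => ?_
  obtain ⟨x, y, hx, hxy⟩ := exists_dual_not_ker_le (K := K) (H := H) (by omega)
  have hlift : ∀ t : Dual K H, ∃ a ∈ relFields T H, restrictField H a = linForm K H t • v := by
    intro t
    have : linForm K H t • v ∈ imagePart T H (d + 1) := by
      rw [hd, add_comm]
      exact ⟨Submodule.smul_mem (logFields _ _) _ hv.1, smul_mem_homogeneous (linForm_mem t) hv.2⟩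
    obtain ⟨a, ha, hav⟩ := this
    exact ⟨a, ha.1, hav⟩
  obtain ⟨a, ha, hav⟩ := hlift x
  obtain ⟨b, hb, hbv⟩ := hlift y
  have hker : restrictField H (linForm K V (extendForm H y) • a -
      linForm K V (extendForm H x) • b) = 0 := by
    rw [map_sub, restrictField_smul, restrictField_smul, res_linForm, res_linForm,
      restrict_extendForm, restrict_extendForm, hav, hbv, smul_comm, sub_self]
  obtain ⟨c, hc, habc⟩ := exists_of_restrictField_eq_zero hT hH hHT
    (sub_mem (Submodule.smul_mem _ _ ha) (Submodule.smul_mem _ _ hb)) hker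
  have hmem : ∀ φ ∈ relFields T H, φ ∈ logFields (insert H T) fun _ => 1 := fun φ hφ =>
    (mem_logFields_insert_iff hH).mpr ⟨φ, hφ, 0, by simp⟩
  obtain ⟨u, w, huw⟩ := Module.Free.exists_eq_smul_add_smul
    (a := (⟨a, hmem a ha⟩ : logFields (insert H T) fun _ => 1)) (b := ⟨b, hmem b hb⟩)
    (c := ⟨c, hmem c hc⟩) (fun f g h => exists_eq_mul_add_mul (ker_form hH) hx hxy)
    (Subtype.ext habc)
  have huw' : a = linForm K V (extendForm H x) • u.1 + linForm K V (form H) • w.1 :=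
    congrArg Subtype.val huw
  obtain ⟨u', hu', p, hup⟩ := (mem_logFields_insert_iff hH).mp u.2
  obtain ⟨w', hw', q, hwq⟩ := (mem_logFields_insert_iff hH).mp w.2
  -- `u` and `w` lie only in D(A). Their Euler parts contribute `x p + α_H q` times the Euler field
  -- to `a`, and this coefficient is 0 because `a`, `u'` and `w'` kill `α_H`.
  have hz : linForm K V (extendForm H x) * p + linForm K V (form H) * q = 0 := by
    have h1 := LinearMap.congr_fun huw' (form H)
    rw [(mem_relFields.mp ha).2, hup, hwq] at h1
    simp only [LinearMap.add_apply, LinearMap.smul_apply, (mem_relFields.mp hu').2,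
      (mem_relFields.mp hw').2, zero_add, smul_eq_mul] at h1
    refine mul_right_cancel₀ (prime_form hH).ne_zero ?_
    rw [zero_mul, h1]
    ring
  have ha' : a = linForm K V (extendForm H x) • u' + linForm K V (form H) • w' := by
    have h1 : a = linForm K V (extendForm H x) • u' + linForm K V (form H) • w' +
        (linForm K V (extendForm H x) * p + linForm K V (form H) * q) • linForm K V := by
      rw [huw', hup, hwq]
      module
    rw [h1, hz, zero_smul, add_zero]
  have hv' : v = restrictField H u' := by
    rw [ha', map_add, restrictField_smul, restrictField_form_smul hH, add_zero, res_linForm,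
      restrict_extendForm] at hav
    exact (smul_left_injective_field (linForm_ne_zero hx) hav).symm
  refine ⟨component d u', ⟨component_mem_relFields hu' d, component_mem d u'⟩, ?_⟩
  rw [restrictField_component, ← hv', component_of_mem hv.2]

/-- Restricting a relation to `H` shows that both coefficients are divisible by `α_H`. Cancelling
and repeating makes them divisible by every power of `α_H`, hence 0. -/
theorem smul_add_smul_eq_zero_of_restrictField (hH : finrank K (V ⧸ H) = 1)
    {φ ψ : FormField K V} {D : Submodule (PolyFun K H) (FormField K H)}
    (hb : IsPairBasis D (restrictField H φ) (restrictField H ψ)) {f g : PolyFun K V}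
    (h : f • φ + g • ψ = 0) : f = 0 ∧ g = 0 := by
  have hp := (prime_form hH).ne_zero
  have key : ∀ N : ℕ, ∀ f g : PolyFun K V, f • φ + g • ψ = 0 →
      linForm K V (form H) ^ N ∣ f ∧ linForm K V (form H) ^ N ∣ g := by
    intro N
    induction N with
    | zero => simp
    | succ N ih =>
      intro f g h
      have h1 := congrArg (restrictField H) h
      rw [map_add, restrictField_smul, restrictField_smul, map_zero] at h1
      obtain ⟨hf, hg⟩ := hb.indep _ _ h1
      obtain ⟨f, rfl⟩ := (res_eq_zero_iff (ker_form hH)).mp hf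
      obtain ⟨g, rfl⟩ := (res_eq_zero_iff (ker_form hH)).mp hg
      rw [mul_smul, mul_smul, ← smul_add] at h
      obtain ⟨hf', hg'⟩ := ih f g (smul_left_injective_field hp (h.trans (smul_zero _).symm))
      rw [pow_succ']
      exact ⟨mul_dvd_mul_left _ hf', mul_dvd_mul_left _ hg'⟩
  have hzero : ∀ f : PolyFun K V, (∀ N, linForm K V (form H) ^ N ∣ f) → f = 0 := by
    intro f hf
    refine eq_zero_of_comp fun d => ?_
    obtain ⟨q, rfl⟩ := hf (d + 1)
    exact comp_mul_of_lt (Nat.lt_succ_self d) (linForm_pow_mem _ _) q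
  exact ⟨hzero f fun N => (key N f g h).1, hzero g fun N => (key N f g h).2⟩

/-- If the restriction map is surjective, then lifts of a homogeneous basis form a basis. -/
theorem isPairBasis_relFields (hV : finrank K V = 3) (hT : ∀ H' ∈ T, finrank K (V ⧸ H') = 1)
    (hH : finrank K (V ⧸ H) = 1) (hHT : H ∉ T) {d₂ d₃ : ℕ} {φ ψ : FormField K V}
    (hφ : φ ∈ relPart T H d₂) (hψ : ψ ∈ relPart T H d₃)
    (hb : IsPairBasis (logFields (restrictions T H) (fiberMult T H))
      (restrictField H φ) (restrictField H ψ)) : IsPairBasis (relFields T H) φ ψ where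
  mem_iff η := by
    have := FiniteDimensional.of_finrank_pos (K := K) (V := V) (by omega)
    constructor
    · suffices hgen : ∀ d, ∀ η ∈ relPart T H d, η ∈ Submodule.span (PolyFun K V) {φ, ψ} by
        intro hη
        have : η ∈ Submodule.span (PolyFun K V) {φ, ψ} := by
          obtain ⟨N, hN⟩ := exists_sum_component η
          rw [hN]
          exact Submodule.sum_mem _ fun d _ =>
            hgen d _ ⟨component_mem_relFields hη d, component_mem d η⟩
        obtain ⟨f, g, h⟩ := Submodule.mem_span_pair.mp this
        exact ⟨f, g, h.symm⟩
      -- Graded Nakayama: modulo the span of `φ` and `ψ`, a field of degree `d` may be assumed to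
      -- restrict to 0. It is then `α_H` times a field of degree `d - 1`, or 0 if `d = 0`, which
      -- allows induction on the degree.
      have hsub : ∀ d, ∀ η ∈ relPart T H d, ∃ ζ ∈ Submodule.span (PolyFun K V) {φ, ψ},
          ζ ∈ relPart T H d ∧ restrictField H (η - ζ) = 0 := by
        rintro d η ⟨h1, h2⟩
        obtain ⟨f, g, hfg⟩ := (hb.mem_iff _).mp (restrictField_mem hT hH hHT h1)
        obtain ⟨f', hf', hf⟩ := exists_component_smul hφ.2 d (extend H f)
        obtain ⟨g', hg', hg⟩ := exists_component_smul hψ.2 d (extend H g)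
        refine ⟨f' • φ + g' • ψ, Submodule.mem_span_pair.mpr ⟨_, _, rfl⟩,
          ⟨add_mem (Submodule.smul_mem (relFields T H) _ hφ.1)
            (Submodule.smul_mem (relFields T H) _ hψ.1),
          add_mem (smul_mem_of_mem_coefficientPart hf' hφ.2)
            (smul_mem_of_mem_coefficientPart hg' hψ.2)⟩, ?_⟩
        have hη : restrictField H η = component d (restrictField H η) :=
          (component_of_mem (restrictField_mem_homogeneous H h2)).symm
        rw [map_sub, hη, map_add, ← hf, ← hg, restrictField_component, restrictField_component,
          restrictField_smul, restrictField_smul, res_extend, res_extend, hfg, sub_eq_zero]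
        exact LinearMap.comp_add _ _ _
      intro d
      induction d with
      | zero =>
        intro η hη
        obtain ⟨ζ, hζ, hζ', h0⟩ := hsub 0 η hη
        have hsubm := sub_mem hη hζ'
        obtain ⟨ξ, -, hξ⟩ := exists_of_restrictField_eq_zero hT hH hHT hsubm.1 h0
        have : η - ζ = 0 := by
          rw [hξ]
          ext α : 1
          by_contra hne
          have h2 := hsubm.2 α
          rw [hξ] at h2
          have := le_of_mul_mem (linForm_mem (form H)) hne h2
          omega
        rwa [sub_eq_zero.mp this]
      | succ d ih =>
        intro η hη
        obtain ⟨ζ, hζ, hζ', h0⟩ := hsub (d + 1) η hη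
        have hsubm := sub_mem hη hζ'
        obtain ⟨ξ, hξ', hξ⟩ := exists_of_restrictField_eq_zero hT hH hHT hsubm.1 h0
        rw [eq_add_of_sub_eq hξ]
        refine add_mem (Submodule.smul_mem _ _ (ih ξ ⟨hξ', fun α => ?_⟩)) hζ
        have h2 := hsubm.2 α
        rw [hξ, add_comm] at h2
        exact mem_of_mul_mem (linForm_mem (form H)) (prime_form hH).ne_zero h2
    · rintro ⟨f, g, rfl⟩
      exact add_mem (Submodule.smul_mem _ _ hφ.1) (Submodule.smul_mem _ _ hψ.1)
  indep f g h := smul_add_smul_eq_zero_of_restrictField hH hb h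

-- D(A) is the direct sum of `relFields` and the multiples of the Euler field, which are free
-- because `α_H ≠ 0` is the value of that field at `α_H`.
open Classical in
theorem free_logFields_of_isPairBasis (hH : finrank K (V ⧸ H) = 1) {φ ψ : FormField K V}
    (hb : IsPairBasis (relFields T H) φ ψ) :
    Module.Free (PolyFun K V) (logFields (insert H T) fun _ => 1) := by
  let F : (relFields T H × PolyFun K V) →ₗ[PolyFun K V] FormField K V :=
    (relFields T H).subtype.coprod (LinearMap.toSpanSingleton _ _ (linForm K V))
  have hF : Function.Injective F := by
    rw [injective_iff_map_eq_zero]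
    rintro ⟨η, f⟩ h
    have h1 : η.1 + f • linForm K V = 0 := h
    have h2 := LinearMap.congr_fun h1 (form H)
    rw [LinearMap.add_apply, (mem_relFields.mp η.2).2, zero_add] at h2
    have hf : f = 0 := (mul_eq_zero.mp h2).resolve_right (prime_form hH).ne_zero
    rw [hf, zero_smul, add_zero] at h1
    exact Prod.ext (Subtype.ext h1) hf
  have hrange : LinearMap.range F = logFields (insert H T) fun _ => 1 := by
    ext η
    rw [mem_logFields_insert_iff hH]
    constructor
    · rintro ⟨⟨ζ, f⟩, rfl⟩
      exact ⟨ζ, ζ.2, f, rfl⟩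
    · rintro ⟨ζ, hζ, f, rfl⟩
      exact ⟨⟨⟨ζ, hζ⟩, f⟩, rfl⟩
  have : Module.Free (PolyFun K V) (relFields T H) := Module.Free.of_basis hb.basis
  rw [← hrange]
  exact Module.Free.of_equiv (LinearEquiv.ofInjective F hF)

open Classical in
/-- An arrangement is free if and only if its second coefficient is the one predicted by the
multiexponents of the restriction. -/
theorem free_logFields_insert_iff (hV : finrank K V = 3)
    (hT : ∀ H' ∈ T, finrank K (V ⧸ H') = 1) (hH : finrank K (V ⧸ H) = 1) (hHT : H ∉ T)
    {d₂ d₃ : ℕ} {θ₂ θ₃ : FormField K H}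
    (h₂ : θ₂ ∈ homogeneous K H d₂) (h₃ : θ₃ ∈ homogeneous K H d₃)
    (hb : IsPairBasis (logFields (restrictions T H) (fiberMult T H)) θ₂ θ₃) :
    Module.Free (PolyFun K V) (logFields (insert H T) fun _ => 1) ↔
      secondCoeff (insert H T) = d₂ + d₃ + d₂ * d₃ := by
  rw [← imagePart_eq_all_iff hV hT hH hHT h₂ h₃ hb]
  constructor
  · intro hfree d
    rcases lt_or_ge (T.card + 1) d with hd | hd
    · exact imagePart_eq_of_card_lt hV hT hH hHT h₂ h₃ hb hd
    -- Descend from degree `T.card + 2`, the first one where surjectivity is known unconditionally.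
    · exact Nat.decreasingInduction
        (motive := fun d _ => imagePart T H d = logPart (restrictions T H) (fiberMult T H) d)
        (fun _ _ h => imagePart_eq_of_succ hV hT hH hHT hfree h)
        (imagePart_eq_of_card_lt hV hT hH hHT h₂ h₃ hb (Nat.lt_succ_self _))
        (hd.trans (Nat.le_succ _))
  · intro h
    obtain ⟨φ, hφ, rfl⟩ : θ₂ ∈ imagePart T H d₂ := by
      rw [h]
      exact ⟨hb.left_mem, h₂⟩
    obtain ⟨ψ, hψ, rfl⟩ : θ₃ ∈ imagePart T H d₃ := by
      rw [h]
      exact ⟨hb.right_mem, h₃⟩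
    exact free_logFields_of_isPairBasis hH (isPairBasis_relFields hV hT hH hHT hφ hψ hb)

/-! ### The main theorem -/

namespace Arrangement

-- The multiplicity in `restrict` counts over all of `A`, including `H`. But `H` restricts to the
-- whole of `H`, which is never one of the lines, so removing it changes no count.
open Classical in
theorem restrict_logFields (A : Arrangement K V) (H : Submodule K V) (hH : H ∈ A.hyperplanes) :
    logFields (A.restrict H hH).hyperplanes (A.restrict H hH).multFun =
      logFields (restrictions (A.hyperplanes.erase H) H)
        (fiberMult (A.hyperplanes.erase H) H) := by
  have hhyp : (A.restrict H hH).hyperplanes = restrictions (A.hyperplanes.erase H) H := rfl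
  rw [hhyp]
  refine logFields_congr fun X hX => ?_
  have hX1 := (A.restrict H hH).codim_one X hX
  rw [MultiArrangement.multFun, dif_pos (show X ∈ (A.restrict H hH).hyperplanes from hX)]
  change (A.hyperplanes.filter fun H' => H'.comap H.subtype = X).card =
    ((A.hyperplanes.erase H).filter fun H' => H'.comap H.subtype = X).card
  rw [Finset.filter_erase, Finset.erase_eq_of_notMem]
  intro h
  have hXtop : X = ⊤ := by
    rw [← (Finset.mem_filter.mp h).2, Submodule.comap_subtype_self]
  rw [hXtop, finrank_zero_iff.mpr inferInstance] at hX1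
  exact zero_ne_one hX1

end Arrangement

end

theorem mainTheorem4 {K V : Type*} [Field K] [CharZero K] [AddCommGroup V]
    [Module K V] (hV : Module.finrank K V = 3) (A : Arrangement K V) (H : Submodule K V)
    (hH : H ∈ A.hyperplanes) :
    (∃ d₂ d₃ : ℕ, (A.restrict H hH).HasExponents {d₂, d₃}) ∧
    ∀ d₂ d₃ : ℕ, (A.restrict H hH).HasExponents {d₂, d₃} →
      (A.IsFree ↔
        A.charPoly = (X - 1) * (X - C (d₂ : ℤ)) * (X - C (d₃ : ℤ))) := by
  classical
  have hH1 := A.codim_one H hH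
  have hT : ∀ H' ∈ A.hyperplanes.erase H, finrank K (V ⧸ H') = 1 := fun H' h =>
    A.codim_one H' (Finset.mem_of_mem_erase h)
  have hHT : H ∉ A.hyperplanes.erase H := Finset.notMem_erase H _
  have := FiniteDimensional.of_finrank_pos (K := K) (V := V) (by omega)
  have hH2 := finrank_add_one_of_finrank_quotient hH1
  constructor
  · obtain ⟨d₂, d₃, -, θ₂, h₂, θ₃, h₃, hb⟩ := exists_homogeneous_isPairBasis (by omega)
      (A.restrict H hH).codim_one (A.restrict H hH).multFun
    exact ⟨d₂, d₃, ((A.restrict H hH).hasExponents_pair_iff d₂ d₃).mpr ⟨θ₂, h₂, θ₃, h₃, hb⟩⟩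
  · intro d₂ d₃ hexp
    obtain ⟨θ₂, h₂, θ₃, h₃, hb⟩ := ((A.restrict H hH).hasExponents_pair_iff d₂ d₃).mp hexp
    rw [A.restrict_logFields H hH] at hb
    have hsum := exponents_add hV hT hH1 hHT h₂ h₃ hb
    have hfree := free_logFields_insert_iff hV hT hH1 hHT h₂ h₃ hb
    rw [Finset.insert_erase hH] at hfree
    have hcard := Finset.card_erase_add_one hH
    rw [A.isFree_iff, hfree, A.charPoly_eq_iff hV hH (by omega)]
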